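/- Let $F_\chi$ be the vacuum module with vacuum $|0\rangle$ for the complex Lie algebra with modes $\chi_n$, $n\in\mathbb Z+\tfrac12$, and relations $[\chi_m,\chi_n]=(-1)^{m-1/2}\delta_{m,-n}$, where $\chi_n|0\rangle=0$ for $n>0$; it has a basis of monomials $\chi_{-j_k}^{m_k}\cdots\chi_{-j_1}^{m_1}|0\rangle$ ($j_k>\dots>j_1>0$ half-integers, $m_i>0$). For $n\in\mathbb Z$ let $h_n=\tfrac12\sum_{k+l=2n}{:}\chi_k\chi_l{:}$ (untwisted Heisenberg algebra, $[h_m,h_n]=-m\,\delta_{m+n,0}$) and $L_0=\tfrac12\sum_{j\ge0}(-1)^j(j+\tfrac12)\,\chi_{-j-1/2}\chi_{j+1/2}$. The charge of a vector is its $h_0$-eigenvalue, and its degree is its $2L_0$-eigenvalue. A highest weight vector is a nonzero $h_0$-eigenvector $v$ with $h_nv=0$ for all $n>0$, and $F^{hwv}_\chi$ is the span of all highest weight vectors. Put $\chi(z)=\sum_n\chi_nz^{-n-1/2}$, $\beta(z^2)=\frac{\chi(z)-\chi(-z)}{2z}$, $\gamma(z^2)=\frac{\chi(z)+\chi(-z)}2$,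 $V^{\pm}(z)=\exp\big(\pm\sum_{n>0}\frac1n h_{\mp n}z^{\pm2n}\big)$, and define the modes $H^{\beta}_{(n)},H^\gamma_{(n)}$, $n\in\mathbb Z$, by $$\sum_n H^\beta_{(n)}z^{-2n-2}=V^+(z)^{-1}\beta(z^2)z^{-2h_0}V^-(z)^{-1},\qquad \sum_n H^\gamma_{(n)}z^{-2n-2}=V^+(z)\gamma(z^2)z^{2h_0}V^-(z).$$ Let $\mathfrak P_{tdo}$ be the set of partitions $\mathfrak p=(T_m,\lambda_1,\dots,\lambda_k)$ with $T_m=\frac{m(m+1)}2$, $m\ge0$, and $\lambda_1>\dots>\lambda_k$ in $\frac12+\mathbb Z_{\ge0}$, $k\ge 0$; its weight is $|\mathfrak p|=T_m+\lambda_1+\dots+\lambda_k$. Let $\mathfrak{BP}_{DI}$ be the set of pairs $(\pi_1|\pi_2)$ of (possibly empty) partitions into distinct positive integers. Write $\#\pi$ for the number of parts and $|\pi|$ for the sum of the parts of $\pi$, and $|(\pi_1|\pi_2)|=|\pi_1|+|\pi_2|$; the Hammond–Lewis birank of $(\pi_1|\pi_2)$ is $\#\pi_2-\#\pi_1$. To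 $(\pi_1|\pi_2)=\big((m_n>\dots>m_1)\,|\,(l_s>\dots>l_1)\big)$ assign the vector $$v_{(\pi_1|\pi_2)}=H^\beta_{(-m_n)}\cdots H^\beta_{(-m_1)}H^\gamma_{(-l_s)}\cdots H^\gamma_{(-l_1)}|0\rangle .$$ Then the vectors $v_{(\pi_1|\pi_2)}$, $(\pi_1|\pi_2)\in\mathfrak{BP}_{DI}$, are highest weight vectors and form a basis of $F^{hwv}_\chi$ indexed by $\mathfrak{BP}_{DI}$, and there is a bijection $\mathfrak P_{tdo}\leftrightarrow\mathfrak{BP}_{DI}$ (hence bijections of both sets with this basis) such that the following hold. 1. The charge of $v_{(\pi_1|\pi_2)}$ is the birank $\#\pi_2-\#\pi_1$. 2. With $n=\#\pi_1$, $s=\#\pi_2$, the degree of $v_{(\pi_1|\pi_2)}$ is $$\mathcal W(\pi_1|\pi_2):=2|(\pi_1|\pi_2)|+2ns-\frac{n(2n-1)}2-\frac{s(2s+1)}2=\frac{3n}2+2|\pi_1|-2T_n+2ns+\frac s2+2|\pi_2|-2T_s\in\tfrac12\mathbb Z_{\ge0}.$$ In particular it is $\frac{3n}{2}+2|\pi_1|-2T_n=2|\pi_1|-\frac{n(2n-1)}2$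 if $\pi_2=\emptyset$, and $\frac s2+2|\pi_2|-2T_s=2|\pi_2|-\frac{s(2s+1)}2$ if $\pi_1=\emptyset$. 3. If $\mathfrak p$ corresponds to $(\pi_1|\pi_2)$, then $|\mathfrak p|=\mathcal W(\pi_1|\pi_2)$, which is the degree of $v_{(\pi_1|\pi_2)}$. The correspondence is not weight-preserving: $|\mathfrak p|\neq|(\pi_1|\pi_2)|$ for some $\mathfrak p$. -/

import Mathlib

namespace CKP

noncomputable section

/-! ### The Fock space -/

/-- The Fock space: the vector space with basis the monomials
`χ_{-j_k}^{m_k} ⋯ χ_{-j_1}^{m_1}|0⟩`. The variable `X i` stands for `χ_{-(i+1/2)}`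
and `1` is the vacuum `|0⟩`. -/
abbrev Fock : Type := MvPolynomial ℕ ℂ

/-- The mode `χ_{i+1/2}`, `i : ℤ`. The mode `χ_{-(j+1/2)}` is multiplication by `X j` and
`χ_{j+1/2}` is `(-1)^j ∂/∂X_j`, for `j ≥ 0`. -/
def chi : ℤ → Module.End ℂ Fock
  | Int.ofNat j => ((-1 : ℂ) ^ j) • (MvPolynomial.pderiv j : Derivation ℂ Fock Fock).toLinearMap
  | Int.negSucc j => LinearMap.mulLeft ℂ (MvPolynomial.X j : Fock)

/-- `χ_n |0⟩ = 0` for `n > 0`. -/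
theorem chi_vacuum (j : ℕ) : chi (Int.ofNat j) 1 = 0 := by
  simp [chi]

/-- The commutation relation `[χ_m, χ_n] = (-1)^{m - 1/2} δ_{m,-n}`, for `m = i + 1/2` and
`n = l + 1/2`. -/
theorem chi_comm (i l : ℤ) :
    chi i * chi l - chi l * chi i = if i + l + 1 = 0 then ((-1 : ℂ) ^ i) • 1 else 0 := by
  rcases i with i | i <;> rcases l with l | l
  · have h : ¬ (Int.ofNat i + Int.ofNat l + 1 = 0) := by
      simp only [Int.ofNat_eq_natCast]; omega
    rw [if_neg h]
    apply LinearMap.ext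
    intro v
    have hc : (MvPolynomial.pderiv i (MvPolynomial.pderiv l v) : Fock)
        = MvPolynomial.pderiv l (MvPolynomial.pderiv i v) := by
      have := congrArg (fun D : Derivation ℂ Fock Fock => D v)
        (show ⁅(MvPolynomial.pderiv i : Derivation ℂ Fock Fock), MvPolynomial.pderiv l⁆ = 0 from by
          apply MvPolynomial.derivation_ext
          intro k
          simp [Derivation.commutator_apply, MvPolynomial.pderiv_X, Pi.single_apply]
          split_ifs <;> simp)
      simpa [Derivation.commutator_apply, sub_eq_zero] using this
    simp [chi, hc, smul_smul, mul_comm]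
  · apply LinearMap.ext
    intro v
    by_cases h : i = l
    · subst h
      have h0 : Int.ofNat i + Int.negSucc i + 1 = 0 := by
        simp only [Int.ofNat_eq_natCast]; omega
      rw [if_pos h0]
      simp [chi, Derivation.leibniz, smul_add]
    · have h0 : ¬ (Int.ofNat i + Int.negSucc l + 1 = 0) := by
        simp only [Int.ofNat_eq_natCast]; omega
      rw [if_neg h0]
      simp [chi, Derivation.leibniz, MvPolynomial.pderiv_X_of_ne (Ne.symm h)]
  · apply LinearMap.ext
    intro v
    by_cases h : i = l
    · subst h
      have h0 : Int.negSucc i + Int.ofNat i + 1 = 0 := by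
        simp only [Int.ofNat_eq_natCast]; omega
      rw [if_pos h0]
      have h1 : ((-1 : ℂ) ^ (Int.negSucc i)) = -(-1) ^ i := by
        rw [zpow_negSucc, pow_succ]
        rcases neg_one_pow_eq_or ℂ i with h | h <;> simp [h]
      rw [h1]
      simp [chi, Derivation.leibniz, smul_add]
    · have h0 : ¬ (Int.negSucc i + Int.ofNat l + 1 = 0) := by
        simp only [Int.ofNat_eq_natCast]; omega
      rw [if_neg h0]
      simp [chi, Derivation.leibniz, MvPolynomial.pderiv_X_of_ne h]
  · have h : ¬ (Int.negSucc i + Int.negSucc l + 1 = 0) := by omega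
    rw [if_neg h]
    apply LinearMap.ext
    intro v
    simp [chi]
    ring

/-- The sum of a locally finite family of endomorphisms: the linear map which is, on each basis
monomial (hence on each vector, see `locSum_apply`), the sum of the finitely many nonzero terms. -/
def locSum {ι : Type} (T : ι → Module.End ℂ Fock) : Module.End ℂ Fock :=
  (MvPolynomial.basisMonomials ℕ ℂ).constr ℂ fun s => ∑ᶠ i, T i (MvPolynomial.monomial s 1)

theorem locSum_apply {ι : Type} (T : ι → Module.End ℂ Fock)
    (hT : ∀ v, (Function.support fun i => T i v).Finite) (v : Fock) :
    locSum T v = ∑ᶠ i, T i v := by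
  let S : Module.End ℂ Fock :=
    { toFun := fun v => ∑ᶠ i, T i v
      map_add' := fun x y => by
        simp only [map_add]
        exact finsum_add_distrib (hT x) (hT y)
      map_smul' := fun c x => by
        simp only [map_smul, RingHom.id_apply]
        exact (smul_finsum' c (hT x)).symm }
  have h : locSum T = S := by
    apply (MvPolynomial.basisMonomials ℕ ℂ).ext
    intro s
    simp [locSum, S, Module.Basis.constr_basis, -MvPolynomial.coe_basisMonomials]
    simp
  rw [h]
  rfl

/-! ### The untwisted Heisenberg algebra and the gradings -/

/-- The normally ordered product `:χ_{i+1/2} χ_{l+1/2}:`. -/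
def normalOrd (i l : ℤ) : Module.End ℂ Fock :=
  if 0 ≤ i then chi l * chi i else chi i * chi l

/-- The untwisted Heisenberg mode `h_n = (1/2) ∑_{k+l=2n} :χ_k χ_l:`, i.e. the coefficient of
`z^{-2n-2}` in `(:χ(z)χ(z): - :χ(-z)χ(-z):) / (4z)`. -/
def heis (n : ℤ) : Module.End ℂ Fock :=
  locSum fun i : ℤ => (1 / 2 : ℂ) • normalOrd i (2 * n - 1 - i)

/-- The Virasoro mode
`L_0 = (1/2) (½ χ_{-1/2}χ_{1/2} - (3/2) χ_{-3/2}χ_{3/2} + (5/2) χ_{-5/2}χ_{5/2} - ⋯)`. -/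
def L0 : Module.End ℂ Fock :=
  locSum fun j : ℕ =>
    ((1 / 2 : ℂ) * (-1) ^ j * (j + 1 / 2)) • (chi (Int.negSucc j) * chi (Int.ofNat j))

/-- `v` is a nonzero vector of charge `c`: an eigenvector of `h_0`. -/
def HasCharge (v : Fock) (c : ℂ) : Prop := v ≠ 0 ∧ heis 0 v = c • v

/-- `v` is a nonzero vector of degree `d`: an eigenvector of `2 L_0`. -/
def HasDegree (v : Fock) (d : ℂ) : Prop := v ≠ 0 ∧ (2 : ℂ) • L0 v = d • v

/-- Highest weight vectors for the untwisted Heisenberg algebra. -/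
def IsHighestWeight (v : Fock) : Prop :=
  (∀ n : ℤ, 0 < n → heis n v = 0) ∧ ∃ c : ℂ, HasCharge v c

/-- The space `F^{hwv}` spanned by the highest weight vectors. -/
def highestWeightSpace : Submodule ℂ Fock := Submodule.span ℂ {v | IsHighestWeight v}

/-- The charge of the monomial with exponents `s`: the `χ_{-(i+1/2)}` with `i` even count `+1`,
those with `i` odd count `-1`. -/
def monomialCharge (s : ℕ →₀ ℕ) : ℤ := s.sum fun i m => (-1) ^ i * (m : ℤ)

/-- The projection onto the span of the monomials of charge `c`. -/
def chargeProj (c : ℤ) : Module.End ℂ Fock :=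
  (MvPolynomial.basisMonomials ℕ ℂ).constr ℂ fun s =>
    if monomialCharge s = c then MvPolynomial.monomial s 1 else 0

/-! ### The fields `H^β` and `H^γ`. We write `w = z²`. -/

/-- The exponential of an operator-valued power series without constant term. -/
def opExp (f : PowerSeries (Module.End ℂ Fock)) : PowerSeries (Module.End ℂ Fock) :=
  PowerSeries.mk fun b =>
    ∑ k ∈ Finset.range (b + 1), (1 / (k.factorial : ℂ)) • PowerSeries.coeff b (f ^ k)

/-- `exp (ε ∑_{n>0} (1/n) h_{-n} w^n)`, a power series in `w`: it is `V⁺` for `ε = 1` and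
`(V⁺)⁻¹` for `ε = -1`. -/
def Vplus (ε : ℂ) : PowerSeries (Module.End ℂ Fock) :=
  opExp (PowerSeries.mk fun n => if n = 0 then 0 else (ε / n) • heis (-n))

/-- `exp (-ε ∑_{n>0} (1/n) h_n w^{-n})`, as a power series in `w⁻¹`: it is `V⁻` for `ε = 1` and
`(V⁻)⁻¹` for `ε = -1`. -/
def Vminus (ε : ℂ) : PowerSeries (Module.End ℂ Fock) :=
  opExp (PowerSeries.mk fun n => if n = 0 then 0 else (-ε / n) • heis n)

/-- The modes of `β(z²) = (χ(z) - χ(-z)) / (2z) = ∑ β_(n) z^{-2n-2}`, namely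
`β_(n) = χ_{2n+1/2}`. -/
def betaMode (n : ℤ) : Module.End ℂ Fock := chi (2 * n)

/-- The modes of `γ(z²) = (χ(z) + χ(-z)) / 2 = ∑ γ_(n) z^{-2n-2}`, namely
`γ_(n) = χ_{2n+3/2}`. -/
def gammaMode (n : ℤ) : Module.End ℂ Fock := chi (2 * n + 1)

/-- The mode `H^β_(n)`: the coefficient of `w^{-n-1}` in `(V⁺)⁻¹ β(w) w^{-h_0} (V⁻)⁻¹`.
The index `(b, c, a)` is the contribution of `w^b` in `(V⁺)⁻¹`, of the charge `c` part (on which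
`w^{-h_0}` is `w^{-c}`) and of `w^{-a}` in `(V⁻)⁻¹`. On each vector only finitely many terms are
nonzero. -/
def Hbeta (n : ℤ) : Module.End ℂ Fock :=
  locSum fun x : ℕ × ℤ × ℕ =>
    PowerSeries.coeff x.1 (Vplus (-1)) * betaMode (n + x.1 - x.2.1 - x.2.2) *
      chargeProj x.2.1 * PowerSeries.coeff x.2.2 (Vminus (-1))

/-- The mode `H^γ_(n)`: the coefficient of `w^{-n-1}` in `V⁺ γ(w) w^{h_0} V⁻`. -/
def Hgamma (n : ℤ) : Module.End ℂ Fock :=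
  locSum fun x : ℕ × ℤ × ℕ =>
    PowerSeries.coeff x.1 (Vplus 1) * gammaMode (n + x.1 + x.2.1 - x.2.2) *
      chargeProj x.2.1 * PowerSeries.coeff x.2.2 (Vminus 1)

/-! ### Partitions and bipartitions -/

/-- The set `𝔓_tdo`: partitions `(T_m, λ_1 > ⋯ > λ_k)` consisting of a triangular number
`T_m = m(m+1)/2`, `m ≥ 0`, and finitely many distinct parts in `1/2 + ℤ_{≥0}`. -/
structure TriDistinctHalf where
  tri : ℕ
  tri_triangular : ∃ m : ℕ, 2 * tri = m * (m + 1)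
  parts : Finset ℚ
  parts_half : ∀ x ∈ parts, ∃ k : ℕ, x = 1 / 2 + k

/-- The weight `|𝔭|`, the sum of all the parts. -/
def TriDistinctHalf.weight (p : TriDistinctHalf) : ℚ := p.tri + ∑ x ∈ p.parts, x

/-- The set `𝔅𝔓_DI` of distinct integer bipartitions `(π₁ | π₂)`: a partition with distinct parts
is given by its finite set of parts. -/
structure DistinctBipartition where
  fst : Finset ℕ+
  snd : Finset ℕ+

/-- The sum of the parts of a partition with distinct parts. -/
def partSum (π : Finset ℕ+) : ℚ := ∑ m ∈ π, ((m : ℕ) : ℚ)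

/-- The weight `|(π₁ | π₂)| = |π₁| + |π₂|`. -/
def DistinctBipartition.weight (π : DistinctBipartition) : ℚ := partSum π.fst + partSum π.snd

/-- The Hammond–Lewis birank `#π₂ - #π₁`. -/
def DistinctBipartition.birank (π : DistinctBipartition) : ℤ :=
  (π.snd.card : ℤ) - (π.fst.card : ℤ)

/-- The function `𝒲(π₁ | π₂) = 2|(π₁ | π₂)| + 2ns - n(2n-1)/2 - s(2s+1)/2`,
`n = #π₁`, `s = #π₂`. -/
def DistinctBipartition.W (π : DistinctBipartition) : ℚ :=
  2 * π.weight + 2 * (π.fst.card : ℚ) * (π.snd.card : ℚ)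
    - (π.fst.card : ℚ) * (2 * (π.fst.card : ℚ) - 1) / 2
    - (π.snd.card : ℚ) * (2 * (π.snd.card : ℚ) + 1) / 2

/-- The triangular number `T_n = n(n+1)/2`. -/
def triangular (n : ℕ) : ℚ := (n : ℚ) * (n + 1) / 2

/-- The vector `H^β_(-m_n) ⋯ H^β_(-m_1) H^γ_(-l_s) ⋯ H^γ_(-l_1)|0⟩` assigned to the bipartition
`(m_n > ⋯ > m_1 | l_s > ⋯ > l_1)`. -/
def DistinctBipartition.vector (π : DistinctBipartition) : Fock :=
  (((π.fst.sort (fun a b => b ≤ a)).map fun m => Hbeta (-((m : ℕ) : ℤ))).prod *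
    ((π.snd.sort (fun a b => b ≤ a)).map fun m => Hgamma (-((m : ℕ) : ℤ))).prod) 1

end

end CKP

namespace CKP

noncomputable section

/-! The Heisenberg modes satisfy `[h_m, χ_j] = -(-1)^j χ_{2m+j}` and `[h_m, h_n] = -m δ`. Let
`vacuumSpace` be the joint kernel of the `h_n`, `n > 0`, and `hNeg` the sum of the images of the
`h_{-n}`. These meet only in zero (`eq_zero_of_mem_hNeg`), so identities between vectors of
`vacuumSpace` can be checked modulo `hNeg` (`eq_of_mkQ_eq`). There `V⁺` becomes the identity, and
moving it to the left past `β` or `γ` costs only a factor `(1 - w/z)^{±1}`.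

Hence the modes of `H^β` and `H^γ` preserve `vacuumSpace` and act on it as symplectic fermions:
modes of the same field anticommute, because `1 - w/z` makes the commuting modes antisymmetric
(`Hmode_anticomm_self`), and `{H^β_m, H^γ_n} = m δ_{m+n,0}` (`Hmode_false_true`). Words in the
creation modes are therefore alternating, and the dual annihilation modes prove their linear
independence (`linearIndependent_vector`). Applying the `h_{-n}` to words yields all of Fock space
(`descendants_eq_top`), so modulo `hNeg` only words remain, and they span `vacuumSpace`
(`vacuumSpace_eq`). Charge and degree are added up one mode at a time.

The bijection is a count in each degree, with `t²` marking degree. Fock space has graded dimension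
`∏ (1 - t^{2j+1})⁻¹`, and passing to `vacuumSpace` multiplies it by `∏ (1 - t^{4j})`. Gauss'
identity `∏ (1 - t^{4j}) = ∏ (1 - t^{4j-2}) ∑ t^{m(m+1)}` turns the result into `∏ (1 + t^{2j+1}) ∑
t^{m(m+1)}`, the generating function of `𝔓_tdo` (`card_tdo_eq`). -/

/-! ### Commutators of the modes `χ` with each other and with the Heisenberg modes. -/

theorem map_finsum_of_finite {ι : Type*} (T : Module.End ℂ Fock) {f : ι → Fock}
    (hf : f.support.Finite) : T (∑ᶠ i, f i) = ∑ᶠ i, T (f i) :=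
  T.toAddMonoidHom.map_finsum hf

/-- A polynomial involves finitely many variables. This makes the infinite sums of modes locally
finite. -/
theorem exists_chi_eq_zero (v : Fock) : ∃ D : ℕ, ∀ i : ℤ, (D : ℤ) ≤ i → chi i v = 0 := by
  refine ⟨v.vars.sup id + 1, fun i hi => ?_⟩
  obtain ⟨j, rfl⟩ := Int.eq_ofNat_of_zero_le (by omega : 0 ≤ i)
  have hj : j ∉ v.vars := fun h => by
    have := Finset.le_sup (f := id) h
    simp only [id] at this
    omega
  change (chi (Int.ofNat j)) v = 0
  simp [chi, MvPolynomial.pderiv_eq_zero_of_notMem_vars hj]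

theorem chi_chi_sub (i l : ℤ) (v : Fock) :
    chi i (chi l v) - chi l (chi i v) = if i + l + 1 = 0 then ((-1 : ℂ) ^ i) • v else 0 := by
  have := congrArg (fun T : Module.End ℂ Fock => T v) (chi_comm i l)
  simp only [LinearMap.sub_apply, Module.End.mul_apply] at this
  rw [this]
  split_ifs <;> simp

theorem chi_chi_comm {i l : ℤ} (h : i + l + 1 ≠ 0) (v : Fock) :
    chi i (chi l v) = chi l (chi i v) := by
  have := chi_chi_sub i l v
  rwa [if_neg h, sub_eq_zero] at this

theorem chi_one_of_nonneg {i : ℤ} (hi : 0 ≤ i) : chi i 1 = 0 := by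
  obtain ⟨j, rfl⟩ := Int.eq_ofNat_of_zero_le hi
  exact chi_vacuum j

/-- Normal ordering changes a product by a scalar only, and scalars drop out of commutators. -/
theorem normalOrd_apply (i l : ℤ) (v : Fock) :
    normalOrd i l v = chi i (chi l v) -
      if 0 ≤ i ∧ i + l + 1 = 0 then ((-1 : ℂ) ^ i) • v else 0 := by
  have h := chi_chi_sub i l v
  unfold normalOrd
  by_cases h0 : 0 ≤ i <;> by_cases h1 : i + l + 1 = 0 <;>
    simp only [h0, h1, if_true, if_false, and_true, Module.End.mul_apply,
      sub_zero, and_false] at h ⊢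
  · rw [← h]; abel
  · rw [sub_eq_zero] at h
    exact h.symm

/-- Normal ordering is symmetric. -/
theorem normalOrd_comm (i l : ℤ) : normalOrd i l = normalOrd l i := by
  refine LinearMap.ext fun v => ?_
  unfold normalOrd
  by_cases h0 : 0 ≤ i <;> by_cases h1 : 0 ≤ l <;> simp only [h0, h1, if_true, if_false]
  · exact chi_chi_comm (by omega) v
  · exact chi_chi_comm (by omega) v

theorem normalOrd_eq_zero {v : Fock} {D : ℕ} (hD : ∀ i : ℤ, (D : ℤ) ≤ i → chi i v = 0)
    {i l : ℤ} (h : (D : ℤ) ≤ i ∨ (D : ℤ) ≤ l) : normalOrd i l v = 0 := by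
  wlog hi : (D : ℤ) ≤ i generalizing i l
  · rw [normalOrd_comm]
    exact this h.symm (h.resolve_left hi)
  · unfold normalOrd
    rw [if_pos (by omega)]
    simp [hD i hi]

theorem normalOrd_finite (n : ℤ) (v : Fock) :
    (Function.support fun i : ℤ => normalOrd i (n - i) v).Finite := by
  obtain ⟨D, hD⟩ := exists_chi_eq_zero v
  refine (Set.finite_Icc (n - D) D).subset fun i hi => ?_
  by_contra h
  refine hi (normalOrd_eq_zero hD ?_)
  simp only [Set.mem_Icc, not_and_or, not_le] at h
  omega

theorem heis_apply (n : ℤ) (v : Fock) :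
    heis n v = ∑ᶠ i : ℤ, (1 / 2 : ℂ) • normalOrd i (2 * n - 1 - i) v := by
  unfold heis
  rw [locSum_apply]
  · simp
  · intro w
    refine (normalOrd_finite (2 * n - 1) w).subset fun i hi h => hi ?_
    simp only [LinearMap.smul_apply, h, smul_zero]

theorem half_normalOrd_finite (n : ℤ) (v : Fock) :
    (Function.support fun i : ℤ => (1 / 2 : ℂ) • normalOrd i (2 * n - 1 - i) v).Finite := by
  refine (normalOrd_finite (2 * n - 1) v).subset fun i hi h => hi ?_
  simp only [h, smul_zero]

theorem neg_one_zpow_add_two_mul (m j : ℤ) : ((-1 : ℂ) ^ (2 * m + j)) = (-1) ^ j := by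
  rw [zpow_add₀ (by norm_num), zpow_mul]
  simp

theorem neg_one_zpow_neg_one_sub (j : ℤ) : ((-1 : ℂ) ^ (-1 - j)) = -(-1) ^ j := by
  rcases Int.even_or_odd j with h | h
  · rw [h.neg_one_zpow, Odd.neg_one_zpow]
    exact Odd.sub_even (by decide) h
  · rw [h.neg_one_zpow, Even.neg_one_zpow, neg_neg]
    exact Odd.sub_odd (by decide) h

/-- `[h_m, χ_j] = -(-1)^j χ_{2m+j}`. -/
theorem heis_chi (m j : ℤ) (v : Fock) :
    heis m (chi j v) = chi j (heis m v) - ((-1 : ℂ) ^ j) • chi (2 * m + j) v := by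
  rw [heis_apply, heis_apply, map_finsum_of_finite _ (half_normalOrd_finite m v)]
  refine Eq.trans (sub_eq_iff_eq_add'.1 ?_) (sub_eq_add_neg _ _).symm
  rw [← finsum_sub_distrib (half_normalOrd_finite m _)]
  swap
  · refine (half_normalOrd_finite m v).subset fun i hi h => hi ?_
    simp only [h, map_zero]
  -- Only the two indices at which one factor of the product pairs with `χ_j` contribute. They
  -- differ by parity, and their two halves add up to the full commutator.
  have key : ∀ i : ℤ, (1 / 2 : ℂ) • normalOrd i (2 * m - 1 - i) (chi j v) -
      chi j ((1 / 2 : ℂ) • normalOrd i (2 * m - 1 - i) v) =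
      (if i = 2 * m + j then (1 / 2 * -(-1 : ℂ) ^ j) • chi (2 * m + j) v else 0) +
      (if i = -1 - j then (1 / 2 * -(-1 : ℂ) ^ j) • chi (2 * m + j) v else 0) := by
    intro i
    have h1 := chi_chi_sub (2 * m - 1 - i) j v
    have h2 := chi_chi_sub i j (chi (2 * m - 1 - i) v)
    rw [normalOrd_apply, normalOrd_apply, map_smul, ← smul_sub]
    have h3 : chi i (chi (2 * m - 1 - i) (chi j v)) - chi j (chi i (chi (2 * m - 1 - i) v)) =
        chi i (if 2 * m - 1 - i + j + 1 = 0 then ((-1 : ℂ) ^ (2 * m - 1 - i)) • v else 0) +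
        (if i + j + 1 = 0 then ((-1 : ℂ) ^ i) • chi (2 * m - 1 - i) v else 0) := by
      rw [← h1, ← h2, map_sub]; abel
    -- The scalar corrections from normal ordering cancel in the commutator.
    have h4 : ∀ a b c d : Fock, c = chi j d → a - c - chi j (b - d) = a - chi j b := by
      intro a b c d h
      rw [h, map_sub]; abel
    rw [h4 _ _ _ _ (by split_ifs <;> simp), h3]
    by_cases hi : i = 2 * m + j
    · have hi' : ¬ i = -1 - j := by omega
      rw [if_pos hi, if_neg hi', if_pos (by omega), if_neg (by omega)]
      have : 2 * m - 1 - i = -1 - j := by omega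
      rw [this, neg_one_zpow_neg_one_sub, hi]
      simp [smul_smul]
    · by_cases hi' : i = -1 - j
      · rw [if_neg hi, if_pos hi', if_neg (by omega), if_pos (by omega)]
        have : 2 * m - 1 - i = 2 * m + j := by omega
        rw [this, hi', neg_one_zpow_neg_one_sub]
        simp [smul_smul]
      · rw [if_neg hi, if_neg hi', if_neg (by omega), if_neg (by omega)]
        simp
  simp_rw [key]
  rw [finsum_add_distrib]
  · rw [finsum_eq_single _ (2 * m + j) (fun x hx => if_neg hx),
      finsum_eq_single _ (-1 - j) (fun x hx => if_neg hx), if_pos rfl, if_pos rfl, ← add_smul]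
    rw [← neg_smul]
    congr 1
    ring
  · exact (Set.finite_singleton (2 * m + j)).subset fun i hi => by
      by_contra h; exact hi (if_neg h)
  · exact (Set.finite_singleton (-1 - j)).subset fun i hi => by
      by_contra h; exact hi (if_neg h)

/-! ### Cyclicity of the vacuum and Schur's lemma. -/

/-- A subspace containing the vacuum and stable under the creation operators is everything. -/
theorem eq_top_of_chi_stable (G : Submodule ℂ Fock) (h1 : (1 : Fock) ∈ G)
    (h : ∀ j : ℕ, ∀ v ∈ G, chi (Int.negSucc j) v ∈ G) : G = ⊤ := by
  refine eq_top_iff.2 fun v _ => ?_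
  induction v using MvPolynomial.induction_on with
  | C a => rw [MvPolynomial.C_eq_smul_one]; exact G.smul_mem a h1
  | add p q hp hq => exact G.add_mem (hp trivial) (hq trivial)
  | mul_X p j hp => rw [mul_comm]; exact h j p (hp trivial)

/-- Vectors killed by all the annihilation operators are multiples of the vacuum. -/
theorem eq_smul_one_of_chi_eq_zero {v : Fock} (h : ∀ j : ℕ, chi (Int.ofNat j) v = 0) :
    ∃ c : ℂ, v = c • 1 := by
  refine ⟨MvPolynomial.coeff 0 v, ?_⟩
  rw [← MvPolynomial.C_eq_smul_one]
  ext s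
  rw [MvPolynomial.coeff_C]
  split_ifs with hs
  · rw [hs]
  · obtain ⟨j, hj⟩ : ∃ j, s j ≠ 0 := by
      by_contra! H
      exact hs (Finsupp.ext fun j => (H j).symm)
    have h2 : MvPolynomial.pderiv j v = 0 := by
      simpa [chi] using h j
    have h3 := MvPolynomial.coeff_pderiv (i := j) v (s - Finsupp.single j 1)
    rw [h2, MvPolynomial.coeff_zero, tsub_add_cancel_of_le] at h3
    · exact (mul_eq_zero.1 h3.symm).resolve_right (Nat.cast_add_one_ne_zero _)
    · rw [Finsupp.single_le_iff]; omega

/-- Operators commuting with all the `χ_i` are scalars. -/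
theorem exists_scalar_of_commute_chi (T : Module.End ℂ Fock)
    (h : ∀ i v, T (chi i v) = chi i (T v)) : ∃ c : ℂ, ∀ v, T v = c • v := by
  obtain ⟨c, hc⟩ : ∃ c : ℂ, T 1 = c • 1 :=
    eq_smul_one_of_chi_eq_zero fun j => by rw [← h, chi_vacuum, map_zero]
  refine ⟨c, fun v => ?_⟩
  let G : Submodule ℂ Fock := LinearMap.eqLocus T (c • LinearMap.id)
  have hG : G = ⊤ := by
    refine eq_top_of_chi_stable G ?_ fun j v hv => ?_
    · exact hc
    · change T _ = c • _
      have : T v = c • v := hv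
      rw [h, this, map_smul, LinearMap.id_apply]
  have : v ∈ G := hG ▸ trivial
  exact this

theorem finsum_mem_submodule {ι : Type*} (G : Submodule ℂ Fock) {f : ι → Fock}
    (h : ∀ i, f i ∈ G) : ∑ᶠ i, f i ∈ G :=
  finsum_induction (· ∈ G) G.zero_mem (fun _ _ => G.add_mem) h

/-! ### Gradings -/

section Grading
variable {M : Type*} [AddCommGroup M]

/-- The amount by which the mode `χ_{i+1/2}` lowers the grading given by the weights `w`. -/
def modeWt (w : ℕ → M) : ℤ → M
  | Int.ofNat j => w j
  | Int.negSucc j => -w j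

/-- The homogeneous component of weight `g`. -/
abbrev gr (w : ℕ → M) (g : M) : Submodule ℂ Fock :=
  MvPolynomial.weightedHomogeneousSubmodule ℂ w g

theorem one_mem_gr (w : ℕ → M) : (1 : Fock) ∈ gr w 0 :=
  MvPolynomial.isWeightedHomogeneous_one ℂ w

theorem chi_mem_gr {w : ℕ → M} {g : M} {v : Fock} (hv : v ∈ gr w g) (i : ℤ) :
    chi i v ∈ gr w (g - modeWt w i) := by
  rcases i with j | j
  · have : MvPolynomial.pderiv j v ∈ gr w (g - w j) := by
      intro s hs
      rw [MvPolynomial.coeff_pderiv] at hs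
      have := hv (left_ne_zero_of_mul hs)
      rw [map_add, Finsupp.weight_single, one_smul] at this
      exact eq_sub_of_add_eq this
    exact Submodule.smul_mem _ _ this
  · have := (MvPolynomial.isWeightedHomogeneous_X ℂ w j).mul hv
    change _ ∈ gr w (g - -w j)
    rw [sub_neg_eq_add, add_comm]
    exact this

theorem heis_mem_gr {w : ℕ → M} {g e : M} {n : ℤ}
    (he : ∀ i, modeWt w i + modeWt w (2 * n - 1 - i) = e) {v : Fock} (hv : v ∈ gr w g) :
    heis n v ∈ gr w (g - e) := by
  rw [heis_apply]
  refine finsum_mem_submodule _ fun i => Submodule.smul_mem _ _ ?_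
  unfold normalOrd
  split_ifs
  · have := chi_mem_gr (chi_mem_gr hv i) (2 * n - 1 - i)
    rwa [sub_sub, he] at this
  · have := chi_mem_gr (chi_mem_gr hv (2 * n - 1 - i)) i
    rwa [sub_sub, add_comm, he] at this

theorem gr_disjoint {w : ℕ → M} {g g' : M} {v : Fock} (h : v ∈ gr w g) (h' : v ∈ gr w g')
    (hg : g ≠ g') : v = 0 := by
  by_contra hv
  exact hg (MvPolynomial.IsWeightedHomogeneous.inj_right hv h h')

/-- The decomposition into homogeneous components. -/
theorem span_homogeneous_induction (w : ℕ → M) {p : Fock → Prop} (h0 : p 0)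
    (hadd : ∀ u v, p u → p v → p (u + v)) (h : ∀ g, ∀ v ∈ gr w g, p v) (v : Fock) : p v := by
  rw [← MvPolynomial.sum_weightedHomogeneousComponent w v]
  exact finsum_induction p h0 hadd fun g =>
    h g _ (MvPolynomial.weightedHomogeneousComponent_mem w v g)

/-- The decomposition into monomials. -/
theorem monomial_induction {p : Fock → Prop} {w : ℕ → M} {g : M} (h0 : p 0)
    (hadd : ∀ u v, p u → p v → p (u + v)) (hsmul : ∀ (a : ℂ) u, p u → p (a • u))
    (h : ∀ s : ℕ →₀ ℕ, Finsupp.weight w s = g → p (MvPolynomial.monomial s 1))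
    {v : Fock} (hv : v ∈ gr w g) : p v := by
  rw [MvPolynomial.as_sum v]
  refine Finset.sum_induction _ p hadd h0 fun s hs => ?_
  rw [show MvPolynomial.monomial s (v.coeff s) = v.coeff s • MvPolynomial.monomial s (1 : ℂ) by
    simp [MvPolynomial.smul_monomial]]
  exact hsmul _ _ (h s (hv (MvPolynomial.mem_support_iff.1 hs)))

end Grading

/-- The charge of `χ_{-(i+1/2)}`. -/
def chargeWt (i : ℕ) : ℤ := (-1) ^ i

/-- Twice the degree of `χ_{-(i+1/2)}`. -/
def degWt (i : ℕ) : ℤ := 2 * i + 1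

theorem modeWt_degWt (i : ℤ) : modeWt degWt i = 2 * i + 1 := by
  rcases i with j | j
  · rfl
  · simp only [modeWt, degWt]; omega

theorem modeWt_chargeWt (i : ℤ) : modeWt chargeWt i = if Even i then 1 else -1 := by
  rcases i with j | j
  · simp only [modeWt, chargeWt, Int.ofNat_eq_natCast, Int.even_coe_nat]
    rcases Nat.even_or_odd j with h | h
    · simp [h]
    · rw [h.neg_one_pow, if_neg (Nat.not_even_iff_odd.2 h)]
  · simp only [modeWt, chargeWt]
    rcases Nat.even_or_odd j with h | h
    · rw [h.neg_one_pow, if_neg]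
      rw [Int.negSucc_eq]
      rcases h with ⟨k, hk⟩
      rintro ⟨l, hl⟩
      omega
    · rw [h.neg_one_pow, if_pos, neg_neg]
      rw [Int.negSucc_eq]
      rcases h with ⟨k, hk⟩
      exact ⟨-k - 1, by omega⟩

theorem chi_mem_deg {d : ℤ} {v : Fock} (hv : v ∈ gr degWt d) (i : ℤ) :
    chi i v ∈ gr degWt (d - (2 * i + 1)) := by
  have := chi_mem_gr hv i
  rwa [modeWt_degWt] at this

theorem heis_mem_deg {d : ℤ} {v : Fock} (hv : v ∈ gr degWt d) (n : ℤ) :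
    heis n v ∈ gr degWt (d - 4 * n) :=
  heis_mem_gr (fun i => by rw [modeWt_degWt, modeWt_degWt]; ring) hv

theorem heis_mem_charge {c : ℤ} {v : Fock} (hv : v ∈ gr chargeWt c) (n : ℤ) :
    heis n v ∈ gr chargeWt c := by
  have := heis_mem_gr (e := 0) (n := n) (fun i => by
    rw [modeWt_chargeWt, modeWt_chargeWt]
    by_cases h : Even i
    · rw [if_pos h, if_neg]
      · rfl
      rw [Int.not_even_iff_odd]
      rcases h with ⟨k, hk⟩
      exact ⟨n - 1 - k, by omega⟩
    · rw [if_neg h, if_pos]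
      · rfl
      rw [Int.not_even_iff_odd] at h
      rcases h with ⟨k, hk⟩
      exact ⟨n - 1 - k, by omega⟩) hv
  rwa [sub_zero] at this

theorem weight_degWt_nonneg (s : ℕ →₀ ℕ) : 0 ≤ Finsupp.weight degWt s := by
  rw [Finsupp.weight_apply]
  exact Finset.sum_nonneg fun i _ => nsmul_nonneg (by unfold degWt; omega) _

/-- Degrees are bounded below: operators lowering the degree enough vanish on a given vector. The
later finiteness arguments for Heisenberg modes rest on this. -/
theorem gr_deg_neg {d : ℤ} (hd : d < 0) {v : Fock} (hv : v ∈ gr degWt d) : v = 0 := by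
  ext s
  by_contra h
  have := hv h
  have := weight_degWt_nonneg s
  omega

theorem heis_one {n : ℤ} (hn : 0 ≤ n) : heis n 1 = 0 := by
  rw [heis_apply]
  refine finsum_eq_zero_of_forall_eq_zero fun i => ?_
  rcases le_or_gt 0 i with h | h
  · rw [normalOrd, if_pos h]
    simp [chi_one_of_nonneg h]
  · rw [normalOrd, if_neg (by omega), Module.End.mul_apply, chi_one_of_nonneg (by omega)]
    simp

/-- Monomials are built one variable at a time, and `[h_0, χ_{-j-1/2}] = (-1)^j χ_{-j-1/2}` adds the
charge of each variable. -/
theorem heis_zero_apply {c : ℤ} {v : Fock} (hv : v ∈ gr chargeWt c) : heis 0 v = (c : ℂ) • v := by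
  have key : ∀ s : ℕ →₀ ℕ, heis 0 (MvPolynomial.monomial s 1) =
      ((Finsupp.weight chargeWt s : ℤ) : ℂ) • MvPolynomial.monomial s 1 := by
    have step : ∀ (s : ℕ →₀ ℕ) (j : ℕ), heis 0 (MvPolynomial.monomial s 1) =
        ((Finsupp.weight chargeWt s : ℤ) : ℂ) • MvPolynomial.monomial s 1 →
        heis 0 (MvPolynomial.monomial (Finsupp.single j 1 + s) 1) =
        ((Finsupp.weight chargeWt (Finsupp.single j 1 + s) : ℤ) : ℂ) •
          MvPolynomial.monomial (Finsupp.single j 1 + s) 1 := by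
      intro s j hs
      have h1 : (MvPolynomial.monomial (Finsupp.single j 1 + s) 1 : Fock) =
          chi (Int.negSucc j) (MvPolynomial.monomial s 1) := by
        simp [chi, MvPolynomial.X, MvPolynomial.monomial_mul]
      rw [h1, heis_chi, hs, map_smul, map_add, Finsupp.weight_single, mul_zero, zero_add, ← sub_smul,
        Int.negSucc_eq, show -((j : ℤ) + 1) = -1 - j by ring, neg_one_zpow_neg_one_sub]
      congr 1
      simp [chargeWt]
      ring
    intro s
    induction s using Finsupp.induction with
    | zero => simpa using heis_one le_rfl
    | single_add j b s _ _ hs =>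
      clear * - hs step
      induction b with
      | zero => simpa using hs
      | succ b ih => rw [add_comm b 1, Finsupp.single_add, add_assoc]; exact step _ j ih
  refine monomial_induction (p := fun v => heis 0 v = (c : ℂ) • v) (by simp) ?_ ?_ ?_ hv
  · intro u v hu hv; rw [map_add, hu, hv, smul_add]
  · intro a u hu; rw [map_smul, hu, smul_comm]
  · intro s hs; rw [key, hs]

theorem monomialCharge_eq (s : ℕ →₀ ℕ) : monomialCharge s = Finsupp.weight chargeWt s := by
  rw [monomialCharge, Finsupp.weight_apply]
  refine Finsupp.sum_congr fun i _ => ?_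
  rw [chargeWt, nsmul_eq_mul, mul_comm]

theorem chargeProj_apply {c : ℤ} {v : Fock} (hv : v ∈ gr chargeWt c) (c' : ℤ) :
    chargeProj c' v = if c' = c then v else 0 := by
  refine monomial_induction (p := fun v => chargeProj c' v = if c' = c then v else 0)
    (by simp) ?_ ?_ ?_ hv
  · intro u v hu hv; rw [map_add, hu, hv]; split_ifs <;> simp
  · intro a u hu; rw [map_smul, hu]; split_ifs <;> simp
  · intro s hs
    have h := (MvPolynomial.basisMonomials ℕ ℂ).constr_basis ℂ
      (fun s => if monomialCharge s = c' then (MvPolynomial.monomial s 1 : Fock) else 0) s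
    rw [MvPolynomial.coe_basisMonomials] at h
    rw [chargeProj, h, monomialCharge_eq, hs]
    simp only [eq_comm]

/-- Each summand of `L0` is a multiple of `X_j ∂_j`, so monomials are eigenvectors. The weight
`degWt` is twice the degree, whence `d / 2`. -/
theorem L0_apply {d : ℤ} {v : Fock} (hv : v ∈ gr degWt d) :
    (2 : ℂ) • L0 v = ((d : ℂ) / 2) • v := by
  refine monomial_induction (p := fun v => (2 : ℂ) • L0 v = ((d : ℂ) / 2) • v)
    (by simp) ?_ ?_ ?_ hv
  · intro u v hu hv; rw [map_add, smul_add, smul_add, hu, hv]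
  · intro a u hu; rw [map_smul, smul_comm, hu, smul_comm]
  · intro s hs
    have h := (MvPolynomial.basisMonomials ℕ ℂ).constr_basis ℂ
      (fun s => ∑ᶠ j : ℕ, (((1 / 2 : ℂ) * (-1) ^ j * (j + 1 / 2)) •
        (chi (Int.negSucc j) * chi (Int.ofNat j))) (MvPolynomial.monomial s 1)) s
    rw [MvPolynomial.coe_basisMonomials] at h
    rw [L0, locSum, h]
    have key : ∀ j : ℕ, (((1 / 2 : ℂ) * (-1) ^ j * (j + 1 / 2)) •
        (chi (Int.negSucc j) * chi (Int.ofNat j))) (MvPolynomial.monomial s 1) =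
        ((1 / 4 : ℂ) * ((s j • degWt j : ℤ) : ℂ)) • (MvPolynomial.monomial s 1 : Fock) := by
      intro j
      have h1 : (chi (Int.negSucc j) * chi (Int.ofNat j)) (MvPolynomial.monomial s 1) =
          ((-1 : ℂ) ^ j * s j) • (MvPolynomial.monomial s 1 : Fock) := by
        have := MvPolynomial.X_mul_pderiv_monomial (i := j) (m := s) (r := (1 : ℂ))
        simp only [chi, Module.End.mul_apply, LinearMap.smul_apply, map_smul,
          LinearMap.mulLeft_apply, Derivation.coeFn_coe, mul_smul]
        rw [this, Nat.cast_smul_eq_nsmul]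
      rw [LinearMap.smul_apply, h1, smul_smul]
      congr 1
      simp only [degWt, nsmul_eq_mul]
      push_cast
      have : ((-1 : ℂ) ^ j) * (-1) ^ j = 1 := by rw [← mul_pow]; simp
      linear_combination (1 / 2 * (j + 1 / 2) * s j : ℂ) * this
    simp_rw [key]
    rw [← hs, Finsupp.weight_apply, finsum_eq_sum_of_support_subset (s := s.support)]
    · rw [← Finset.sum_smul, ← Finset.mul_sum, smul_smul, Finsupp.sum]
      push_cast
      congr 1
      ring
    · intro j hj
      rw [Finset.mem_coe, Finsupp.mem_support_iff]
      rintro h0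
      exact hj (by simp [h0])

/-! ### The Heisenberg relations -/

/-- Evaluating on the vacuum fixes the central term. Exactly `2m` products in `h_{-m}|0⟩` consist of
two creation operators, and each contributes `-1/2`. -/
theorem heis_heis_neg_one (m : ℕ) : heis m (heis (-m) 1) = -(m : ℂ) • (1 : Fock) := by
  rw [heis_apply (-m), map_finsum_of_finite _ (half_normalOrd_finite _ _)]
  have key : ∀ i : ℤ, heis m ((1 / 2 : ℂ) • normalOrd i (2 * (-m : ℤ) - 1 - i) 1) =
      if i ∈ Finset.Icc (-2 * m : ℤ) (-1) then (-1 / 2 : ℂ) • (1 : Fock) else 0 := by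
    intro i
    rw [map_smul]
    split_ifs with h <;> rw [Finset.mem_Icc] at h
    · obtain ⟨l, hl⟩ : ∃ l, l = 2 * (-m : ℤ) - 1 - i := ⟨_, rfl⟩
      rw [← hl, normalOrd, if_neg (by omega), Module.End.mul_apply, heis_chi, heis_chi,
        heis_one (by omega), chi_one_of_nonneg (i := 2 * m + l) (by omega)]
      have h1 := chi_chi_sub (2 * m + i) l 1
      rw [chi_one_of_nonneg (i := 2 * m + i) (by omega), map_zero, sub_zero, if_pos (by omega),
        neg_one_zpow_add_two_mul] at h1
      rw [h1, map_zero, smul_zero, sub_zero, map_zero, zero_sub, smul_smul, smul_neg, smul_smul,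
        ← neg_smul]
      congr 1
      have h2 : ((-1 : ℂ) ^ i) * (-1) ^ i = 1 := by
        rw [← mul_zpow]; simp
      rw [h2]; ring
    · rcases le_or_gt 0 i with h0 | h0
      · rw [normalOrd, if_pos h0, Module.End.mul_apply, chi_one_of_nonneg h0]
        simp
      · rw [normalOrd, if_neg (by omega), Module.End.mul_apply, chi_one_of_nonneg (by omega)]
        simp
  simp_rw [key]
  rw [finsum_eq_sum_of_support_subset (s := Finset.Icc (-2 * m : ℤ) (-1))]
  · rw [Finset.sum_ite_mem, Finset.inter_self, Finset.sum_const, Int.card_Icc,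
      ← Nat.cast_smul_eq_nsmul ℂ, smul_smul]
    congr 1
    rw [show (-1 + 1 - -2 * (m : ℤ)).toNat = 2 * m by omega]
    push_cast
    ring
  · intro i hi
    by_contra h
    exact hi (if_neg h)

/-- `[h_m, h_n] = -m δ_{m+n,0}`. -/
theorem heis_comm (m n : ℤ) (v : Fock) :
    heis m (heis n v) = heis n (heis m v) - if m + n = 0 then (m : ℂ) • v else 0 := by
  -- The commutator of two Heisenberg modes commutes with every `χ_i`, so it is a scalar that can be
  -- read off on the vacuum.
  obtain ⟨c, hc⟩ := exists_scalar_of_commute_chi (heis m * heis n - heis n * heis m) (by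
    intro i v
    simp only [LinearMap.sub_apply, Module.End.mul_apply, heis_chi, map_sub, map_smul,
      neg_one_zpow_add_two_mul, smul_sub]
    rw [show 2 * n + (2 * m + i) = 2 * m + (2 * n + i) by ring]
    abel)
  simp only [LinearMap.sub_apply, Module.End.mul_apply] at hc
  refine Eq.trans (sub_eq_iff_eq_add'.1 ?_) (sub_eq_add_neg _ _).symm
  rw [hc]
  split_ifs with h
  · obtain rfl : n = -m := by omega
    rw [← neg_smul]
    congr 1
    have h1 := hc 1
    obtain ⟨k, rfl | rfl⟩ := m.eq_nat_or_neg
    · rw [heis_heis_neg_one, heis_one (by omega), map_zero, sub_zero] at h1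
      have := smul_left_injective ℂ (one_ne_zero : (1 : Fock) ≠ 0) h1
      rw [← this]; simp
    · rw [neg_neg, heis_heis_neg_one, heis_one (by omega), map_zero, zero_sub, ← neg_smul] at h1
      have := smul_left_injective ℂ (one_ne_zero : (1 : Fock) ≠ 0) h1
      rw [← this]; simp
  · rw [neg_zero]
    have h1 := hc 1
    -- For `m + n ≠ 0` the commutator shifts the degree, which a nonzero scalar cannot do.
    have h2 : c • (1 : Fock) ∈ gr degWt (-4 * (m + n)) := by
      rw [← h1]
      have e1 := heis_mem_deg (heis_mem_deg (one_mem_gr degWt) n) m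
      have e2 := heis_mem_deg (heis_mem_deg (one_mem_gr degWt) m) n
      rw [show 0 - 4 * n - 4 * m = -4 * (m + n) by ring] at e1
      rw [show 0 - 4 * m - 4 * n = -4 * (m + n) by ring] at e2
      exact Submodule.sub_mem _ e1 e2
    have h3 := gr_disjoint h2 (Submodule.smul_mem _ c (one_mem_gr degWt)) (by omega)
    rcases smul_eq_zero.1 h3 with h4 | h4
    · rw [h4, zero_smul]
    · exact absurd h4 one_ne_zero

/-! ### Exponentials -/

section Exponential

/-- The Euler operator on operator-valued power series. -/
def euler (f : PowerSeries (Module.End ℂ Fock)) : PowerSeries (Module.End ℂ Fock) :=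
  PowerSeries.mk fun n => n • PowerSeries.coeff n f

theorem euler_mul (f g : PowerSeries (Module.End ℂ Fock)) :
    euler (f * g) = euler f * g + f * euler g := by
  ext1 n
  simp only [euler, PowerSeries.coeff_mk, map_add, PowerSeries.coeff_mul, Finset.smul_sum]
  rw [← Finset.sum_add_distrib]
  refine Finset.sum_congr rfl fun x hx => ?_
  rw [← Finset.HasAntidiagonal.mem_antidiagonal.1 hx, add_smul, smul_mul_assoc, mul_smul_comm]

variable {f : PowerSeries (Module.End ℂ Fock)}

/-- Operators do not commute in general; commuting coefficients give the usual power rule. -/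
theorem euler_pow (hf : ∀ i j, Commute (PowerSeries.coeff i f) (PowerSeries.coeff j f)) (k : ℕ) :
    euler (f ^ (k + 1)) = (k + 1) • (euler f * f ^ k) := by
  have hc : f * euler f = euler f * f := by
    ext1 n
    rw [PowerSeries.coeff_mul, PowerSeries.coeff_mul, ← Finset.Nat.sum_antidiagonal_swap]
    refine Finset.sum_congr rfl fun x _ => ?_
    simp only [euler, PowerSeries.coeff_mk, Prod.fst_swap, Prod.snd_swap]
    exact ((hf x.2 x.1).smul_right _).eq
  induction k with
  | zero => simp
  | succ k ih =>
    rw [pow_succ' f (k + 1), euler_mul, ih, mul_smul_comm, ← mul_assoc, hc, mul_assoc, ← pow_succ',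
      add_smul (k + 1), one_smul, add_comm]

theorem coeff_pow_eq_zero (h0 : PowerSeries.coeff 0 f = 0) (k b : ℕ) (h : b < k) :
    PowerSeries.coeff b (f ^ k) = 0 := by
  induction k generalizing b with
  | zero => omega
  | succ k ih =>
    rw [pow_succ', PowerSeries.coeff_mul]
    refine Finset.sum_eq_zero fun x hx => ?_
    rw [Finset.HasAntidiagonal.mem_antidiagonal] at hx
    rcases Nat.eq_zero_or_pos x.1 with h1 | h1
    · rw [h1, h0, zero_mul]
    · rw [ih _ (by omega), mul_zero]

theorem coeff_opExp (h0 : PowerSeries.coeff 0 f = 0) {b N : ℕ} (h : b < N) :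
    PowerSeries.coeff b (opExp f) =
      ∑ k ∈ Finset.range N, (1 / (k.factorial : ℂ)) • PowerSeries.coeff b (f ^ k) := by
  rw [opExp, PowerSeries.coeff_mk]
  refine Finset.sum_subset (Finset.range_mono h) fun k _ hk => ?_
  rw [Finset.mem_range, not_lt] at hk
  rw [coeff_pow_eq_zero h0 k b hk, smul_zero]

theorem coeff_zero_opExp (h0 : PowerSeries.coeff 0 f = 0) :
    PowerSeries.coeff 0 (opExp f) = 1 := by
  rw [coeff_opExp h0 zero_lt_one]
  simp

/-- The differential equation of the exponential. -/
theorem smul_coeff_opExp (h0 : PowerSeries.coeff 0 f = 0)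
    (hf : ∀ i j, Commute (PowerSeries.coeff i f) (PowerSeries.coeff j f)) (b : ℕ) :
    (b : ℂ) • PowerSeries.coeff b (opExp f) = ∑ x ∈ Finset.HasAntidiagonal.antidiagonal b,
      ((x.1 : ℂ) • PowerSeries.coeff x.1 f) * PowerSeries.coeff x.2 (opExp f) := by
  -- A term with `x.1 = 0` has coefficient zero. Otherwise `x.2 < b`, so all exponentials can be
  -- truncated at the same order `b`.
  have h1 : ∀ x ∈ Finset.HasAntidiagonal.antidiagonal b,
      ((x.1 : ℂ) • PowerSeries.coeff x.1 f) * PowerSeries.coeff x.2 (opExp f) =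
      ∑ k ∈ Finset.range b, (1 / (k.factorial : ℂ)) •
        (((x.1 : ℂ) • PowerSeries.coeff x.1 f) * PowerSeries.coeff x.2 (f ^ k)) := by
    intro x hx
    rw [Finset.HasAntidiagonal.mem_antidiagonal] at hx
    rcases Nat.eq_zero_or_pos x.1 with h1 | h1
    · simp [h1]
    · rw [coeff_opExp h0 (show x.2 < b by omega), Finset.mul_sum]
      exact Finset.sum_congr rfl fun k _ => mul_smul_comm _ _ _
  rw [Finset.sum_congr rfl h1, Finset.sum_comm, coeff_opExp h0 (Nat.lt_succ_self b),
    Finset.sum_range_succ', smul_add, Finset.smul_sum]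
  rw [show ((b : ℂ) • (1 / ((Nat.factorial 0 : ℕ) : ℂ)) • PowerSeries.coeff b (f ^ 0)) = 0 by
    rw [pow_zero, PowerSeries.coeff_one]
    split_ifs with h <;> simp [h], add_zero]
  refine Finset.sum_congr rfl fun k _ => ?_
  have h2 := congrArg (PowerSeries.coeff b) (euler_pow hf k)
  rw [euler, PowerSeries.coeff_mk, map_nsmul, PowerSeries.coeff_mul,
    ← Nat.cast_smul_eq_nsmul ℂ, ← Nat.cast_smul_eq_nsmul ℂ] at h2
  rw [smul_comm, h2, ← Finset.smul_sum, smul_smul]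
  congr 1
  · rw [Nat.factorial_succ]
    have : ((k + 1 : ℕ) : ℂ) ≠ 0 := Nat.cast_ne_zero.2 (Nat.succ_ne_zero k)
    have : (k.factorial : ℂ) ≠ 0 := Nat.cast_ne_zero.2 (Nat.factorial_ne_zero k)
    push_cast at *
    field_simp
  · refine Finset.sum_congr rfl fun x _ => ?_
    rw [euler, PowerSeries.coeff_mk, Nat.cast_smul_eq_nsmul]

end Exponential

/-- The coefficients of `Vplus`, extended by zero to negative indices. -/
def vp (ε : ℂ) (b : ℤ) : Module.End ℂ Fock :=
  if b < 0 then 0 else PowerSeries.coeff b.toNat (Vplus ε)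

theorem vp_natCast (ε : ℂ) (b : ℕ) : vp ε b = PowerSeries.coeff b (Vplus ε) := by
  rw [vp, if_neg (by omega), Int.toNat_natCast]

theorem vp_of_neg (ε : ℂ) {b : ℤ} (h : b < 0) : vp ε b = 0 := if_pos h

theorem commute_heis {m n : ℤ} (h : m + n ≠ 0) : Commute (heis m) (heis n) := by
  refine LinearMap.ext fun v => ?_
  rw [Module.End.mul_apply, Module.End.mul_apply, heis_comm, if_neg h, sub_zero]

theorem vp_zero (ε : ℂ) : vp ε 0 = 1 := by
  rw [vp, if_neg (by omega)]
  exact coeff_zero_opExp (by simp)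

/-- This is the differential equation of the exponential, read as a recursion for `V⁺`. The upper
limit `N` is free because negative coefficients vanish, so one range can serve several values of
`b`. -/
theorem smul_vp (ε : ℂ) {b : ℤ} {N : ℕ} (h : b ≤ N) (u : Fock) :
    (b : ℂ) • vp ε b u =
      ε • ∑ i ∈ Finset.range N, heis (-(i + 1 : ℤ)) (vp ε (b - 1 - i) u) := by
  rcases lt_or_ge b 0 with h0 | h0
  · rw [vp_of_neg ε h0, Finset.sum_eq_zero]
    · simp
    · intro i _
      rw [vp_of_neg ε (by omega)]; simp
  obtain ⟨b, rfl⟩ := Int.eq_ofNat_of_zero_le h0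
  rw [vp_natCast, ← LinearMap.smul_apply]
  simp only [Int.cast_natCast]
  rw [Vplus, smul_coeff_opExp (by simp), ← Vplus]
  · rcases b with _ | b
    · rw [Finset.sum_eq_zero (s := Finset.range N)]
      · simp
      · intro i _
        rw [vp_of_neg ε (by omega)]; simp
    · rw [Finset.Nat.sum_antidiagonal_succ, Finset.Nat.sum_antidiagonal_eq_sum_range_succ_mk,
        ← Finset.sum_subset (Finset.range_mono (show b.succ ≤ N by omega))]
      · simp only [Nat.cast_zero, zero_smul, zero_mul, zero_add, LinearMap.sum_apply,
          Finset.smul_sum]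
        refine Finset.sum_congr rfl fun i hi => ?_
        rw [Finset.mem_range] at hi
        rw [PowerSeries.coeff_mk, if_neg (by omega), smul_smul, mul_div_cancel₀,
          show ((b + 1 : ℕ) : ℤ) - 1 - i = ((b - i : ℕ) : ℤ) by omega, vp_natCast]
        · simp
        · exact Nat.cast_ne_zero.2 (by omega)
      · intro i _ hi
        rw [Finset.mem_range] at hi
        rw [vp_of_neg ε (by omega)]; simp
  · intro i j
    rw [PowerSeries.coeff_mk, PowerSeries.coeff_mk]
    split_ifs
    · exact Commute.zero_left _
    · exact Commute.zero_left _
    · exact Commute.zero_right _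
    · exact ((commute_heis (by omega)).smul_right _).smul_left _

/-! ### The vacuum space of the Heisenberg algebra -/

/-- The joint kernel of the `h_n`, `n > 0`. -/
def vacuumSpace : Submodule ℂ Fock := ⨅ k : ℕ, LinearMap.ker (heis (k + 1))

theorem mem_vacuumSpace {v : Fock} : v ∈ vacuumSpace ↔ ∀ n : ℤ, 0 < n → heis n v = 0 := by
  simp only [vacuumSpace, Submodule.mem_iInf, LinearMap.mem_ker]
  refine ⟨fun h n hn => ?_, fun h k => h _ (by omega)⟩
  have := h (n - 1).toNat
  rwa [show (((n - 1).toNat : ℕ) : ℤ) + 1 = n by omega] at this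

/-- The sum of the images of the `h_{-n}`, `n > 0`. -/
def hNeg : Submodule ℂ Fock := ⨆ k : ℕ, LinearMap.range (heis (-(k + 1)))

theorem heis_mem_hNeg (i : ℕ) (u : Fock) : heis (-(i + 1 : ℤ)) u ∈ hNeg :=
  Submodule.mem_iSup_of_mem i (LinearMap.mem_range_self _ u)

theorem heis_pow_finite {n : ℤ} (hn : 0 < n) (v : Fock) :
    ∃ N : ℕ, ∀ j, N ≤ j → (heis n ^ j) v = 0 := by
  refine span_homogeneous_induction degWt (p := fun v => ∃ N : ℕ, ∀ j, N ≤ j → (heis n ^ j) v = 0)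
    ⟨0, fun j _ => map_zero _⟩ ?_ ?_ v
  · rintro u v ⟨N, hN⟩ ⟨N', hN'⟩
    refine ⟨max N N', fun j hj => ?_⟩
    rw [map_add, hN j ((le_max_left _ _).trans hj), hN' j ((le_max_right _ _).trans hj), add_zero]
  · intro d v hv
    have key : ∀ j : ℕ, (heis n ^ j) v ∈ gr degWt (d - 4 * n * j) := by
      intro j
      induction j with
      | zero => simpa using hv
      | succ j ih =>
        rw [pow_succ', Module.End.mul_apply]
        have := heis_mem_deg ih n
        rwa [show d - 4 * n * j - 4 * n = d - 4 * n * (j + 1 : ℕ) by push_cast; ring] at this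
    refine ⟨d.toNat + 1, fun j hj => gr_deg_neg ?_ (key j)⟩
    have : (j : ℤ) ≤ n * j := le_mul_of_one_le_left (by omega) hn
    have h2 : (d.toNat : ℤ) + 1 ≤ j := by exact_mod_cast hj
    have := Int.self_le_toNat d
    rw [mul_assoc]
    omega

/-- The projection onto the kernel of `h_n` along the image of `h_{-n}`, `n > 0`. -/
def kerProj (n : ℤ) : Module.End ℂ Fock :=
  locSum fun j : ℕ => (1 / (j.factorial * (n : ℂ) ^ j)) • (heis (-n) ^ j * heis n ^ j)

theorem kerProj_finite {n : ℤ} (hn : 0 < n) (v : Fock) : (Function.support fun j : ℕ =>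
    ((1 / (j.factorial * (n : ℂ) ^ j)) • (heis (-n) ^ j * heis n ^ j)) v).Finite := by
  obtain ⟨N, hN⟩ := heis_pow_finite hn v
  refine (Finset.range N).finite_toSet.subset fun j hj => ?_
  by_contra h
  rw [Finset.mem_coe, Finset.mem_range, not_lt] at h
  refine hj ?_
  simp only [LinearMap.smul_apply, Module.End.mul_apply, hN j h, map_zero, smul_zero]

theorem kerProj_of_ker {n : ℤ} (hn : 0 < n) {v : Fock} (hv : heis n v = 0) : kerProj n v = v := by
  rw [kerProj, locSum_apply _ (kerProj_finite hn), finsum_eq_single _ 0]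
  · simp
  · intro j hj
    obtain ⟨j, rfl⟩ := Nat.exists_eq_succ_of_ne_zero hj
    rw [LinearMap.smul_apply, Module.End.mul_apply, pow_succ (heis n), Module.End.mul_apply, hv]
    simp

/-- Each factor `h_n` moved past `h_{-n}` leaves one central term `-n`. -/
theorem heis_pow_heis_neg (n : ℤ) (j : ℕ) (u : Fock) :
    (heis n ^ (j + 1)) (heis (-n) u) =
      heis (-n) ((heis n ^ (j + 1)) u) - ((j + 1 : ℂ) * n) • (heis n ^ j) u := by
  induction j with
  | zero => simp [heis_comm n (-n)]
  | succ j ih =>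
    rw [pow_succ' (heis n) (j + 1), Module.End.mul_apply, ih, map_sub, heis_comm n (-n),
      if_pos (by ring), map_smul,
      show heis n ((heis n ^ j) u) = (heis n ^ (j + 1)) u by rw [pow_succ', Module.End.mul_apply],
      sub_sub, ← add_smul, Module.End.mul_apply]
    congr 2
    push_cast
    ring

theorem kerProj_heis_neg {n : ℤ} (hn : 0 < n) (u : Fock) : kerProj n (heis (-n) u) = 0 := by
  obtain ⟨N, hN⟩ := heis_pow_finite hn u
  obtain ⟨N', hN'⟩ := heis_pow_finite hn (heis (-n) u)
  have hn0 : (n : ℂ) ≠ 0 := Int.cast_ne_zero.2 hn.ne'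
  rw [kerProj, locSum_apply _ (kerProj_finite hn),
    finsum_eq_sum_of_support_subset (s := Finset.range (N + N' + 1))]
  · have key : ∀ M : ℕ, ∑ j ∈ Finset.range (M + 1),
        ((1 / (j.factorial * (n : ℂ) ^ j)) • (heis (-n) ^ j * heis n ^ j)) (heis (-n) u) =
        (1 / (M.factorial * (n : ℂ) ^ M)) • (heis (-n) ^ (M + 1)) ((heis n ^ M) u) := by
      intro M
      induction M with
      | zero => simp
      | succ M ih =>
        rw [Finset.sum_range_succ, ih, LinearMap.smul_apply, Module.End.mul_apply,
          heis_pow_heis_neg, map_sub, map_smul, smul_sub, smul_smul,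
          pow_succ (heis (-n)) (M + 1), Module.End.mul_apply, add_comm, sub_add, sub_eq_self,
          sub_eq_zero]
        congr 1
        rw [Nat.factorial_succ, pow_succ]
        have : (M.factorial : ℂ) ≠ 0 := Nat.cast_ne_zero.2 (Nat.factorial_ne_zero M)
        have : (M + 1 : ℂ) ≠ 0 := Nat.cast_add_one_ne_zero M
        push_cast
        field_simp
    rw [key, hN _ (by omega)]
    simp
  · intro j hj
    by_contra h
    rw [Finset.mem_coe, Finset.mem_range, not_lt] at h
    refine hj ?_
    simp only [LinearMap.smul_apply, Module.End.mul_apply, hN' j (by omega), map_zero, smul_zero]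

theorem kerProj_heis_of_ne {n m : ℤ} (hn : 0 < n) (h1 : n + m ≠ 0) (h2 : -n + m ≠ 0) (u : Fock) :
    kerProj n (heis m u) = heis m (kerProj n u) := by
  rw [kerProj, locSum_apply _ (kerProj_finite hn), locSum_apply _ (kerProj_finite hn),
    map_finsum_of_finite _ (kerProj_finite hn u)]
  refine finsum_congr fun j => ?_
  have h : Commute (heis (-n) ^ j * heis n ^ j) (heis m) :=
    ((commute_heis h2).pow_left j).mul_left ((commute_heis h1).pow_left j)
  have := congrArg (fun T : Module.End ℂ Fock => T u) h.eq
  simp only [Module.End.mul_apply] at this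
  simp only [LinearMap.smul_apply, Module.End.mul_apply, map_smul, this]

/-- The projections strip off the summands of `hNeg` one by one. The projection for `n` fixes the
vacuum vector `v`, kills the image of `h_{-n}`, and preserves the images of the other `h_{-m}`. -/
theorem eq_zero_of_mem_hNeg {v : Fock} (hv : v ∈ vacuumSpace) (hv' : v ∈ hNeg) : v = 0 := by
  rw [hNeg, Submodule.mem_iSup_iff_exists_finset] at hv'
  obtain ⟨s, hs⟩ := hv'
  rw [mem_vacuumSpace] at hv
  induction s using Finset.induction_on with
  | empty => simpa using hs
  | insert k s hk ih =>
    refine ih ?_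
    rw [Finset.iSup_insert, Submodule.mem_sup] at hs
    obtain ⟨_, ⟨u, rfl⟩, w, hw, rfl⟩ := hs
    have h1 := kerProj_of_ker (n := k + 1) (by omega) (hv (k + 1) (by omega))
    rw [map_add, kerProj_heis_neg (by omega), zero_add] at h1
    rw [← h1]
    have : ⨆ i ∈ s, LinearMap.range (heis (-(i + 1 : ℤ))) ≤
        (⨆ i ∈ s, LinearMap.range (heis (-(i + 1 : ℤ)))).comap (kerProj (k + 1)) := by
      refine iSup₂_le fun i hi => ?_
      rintro _ ⟨u, rfl⟩
      have hik : i ≠ k := fun h => hk (h ▸ hi)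
      rw [Submodule.mem_comap, kerProj_heis_of_ne (by omega) (by omega) (by omega)]
      exact Submodule.mem_iSup_of_mem i (Submodule.mem_iSup_of_mem hi (LinearMap.mem_range_self _ _))
    exact this hw

/-- The principle behind the fermion relations: vacuum vectors are determined by their classes
modulo `hNeg`, where the creating exponentials simplify. -/
theorem eq_of_mkQ_eq {u v : Fock} (hu : u ∈ vacuumSpace) (hv : v ∈ vacuumSpace)
    (h : hNeg.mkQ u = hNeg.mkQ v) : u = v :=
  sub_eq_zero.1 (eq_zero_of_mem_hNeg (vacuumSpace.sub_mem hu hv)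
    ((Submodule.Quotient.eq hNeg).1 h))

theorem mkQ_heis_neg (i : ℕ) (u : Fock) : hNeg.mkQ (heis (-(i + 1 : ℤ)) u) = 0 :=
  (Submodule.Quotient.mk_eq_zero _).2 (heis_mem_hNeg i u)

theorem mkQ_heis_of_neg {n : ℤ} (hn : n < 0) (u : Fock) : hNeg.mkQ (heis n u) = 0 := by
  have := mkQ_heis_neg (-n - 1).toNat u
  rwa [show -((((-n - 1).toNat : ℕ) : ℤ) + 1) = n by omega] at this

/-! ### The fields `β` and `γ` and the exponentials -/

/-- The sign of the charge: `1` for `γ` (`true`) and `-1` for `β` (`false`). -/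
def sg (s : Bool) : ℤ := if s then 1 else -1

theorem sg_mul_sg (s : Bool) : sg s * sg s = 1 := by cases s <;> rfl

theorem sg_not (s : Bool) : sg (!s) = -sg s := by cases s <;> rfl

/-- The modes of `γ` (`true`) and `β` (`false`). -/
def mode (s : Bool) (n : ℤ) : Module.End ℂ Fock := chi (2 * n + if s then 1 else 0)

theorem mode_false (n : ℤ) : mode false n = betaMode n := by simp [mode, betaMode]

theorem mode_true (n : ℤ) : mode true n = gammaMode n := by simp [mode, gammaMode]

theorem heis_mode (m : ℤ) (s : Bool) (n : ℤ) (v : Fock) :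
    heis m (mode s n v) = mode s n (heis m v) + (sg s : ℂ) • mode s (m + n) v := by
  rw [mode, heis_chi, sub_eq_add_neg, ← neg_smul, neg_one_zpow_add_two_mul, mode,
    show 2 * (m + n) = 2 * m + 2 * n by ring, add_assoc]
  cases s <;> simp [sg]

theorem mode_heis (m : ℤ) (s : Bool) (n : ℤ) (v : Fock) :
    mode s n (heis m v) = heis m (mode s n v) - (sg s : ℂ) • mode s (m + n) v := by
  rw [heis_mode, add_sub_cancel_right]

theorem mode_comm_self (s : Bool) (m n : ℤ) (v : Fock) :
    mode s m (mode s n v) = mode s n (mode s m v) :=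
  chi_chi_comm (by cases s <;> simp <;> omega) v

theorem mode_false_mode_true (m n : ℤ) (v : Fock) :
    mode false m (mode true n v) =
      mode true n (mode false m v) + if m + n + 1 = 0 then v else 0 := by
  have h := chi_chi_sub (2 * m + 0) (2 * n + 1) v
  rw [neg_one_zpow_add_two_mul, zpow_zero, one_smul] at h
  rw [← sub_eq_iff_eq_add']
  refine h.trans ?_
  by_cases h1 : m + n + 1 = 0
  · rw [if_pos h1, if_pos (by omega)]
  · rw [if_neg h1, if_neg (by omega)]

theorem exists_mode_eq_zero (v : Fock) : ∃ D : ℕ, ∀ s n, (D : ℤ) ≤ n → mode s n v = 0 := by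
  obtain ⟨D, hD⟩ := exists_chi_eq_zero v
  exact ⟨D, fun s n h => hD _ (by cases s <;> simp <;> omega)⟩

theorem mode_mem_deg {d : ℤ} {v : Fock} (hv : v ∈ gr degWt d) (s : Bool) (n : ℤ) :
    mode s n v ∈ gr degWt (d - (4 * n + 2 + sg s)) := by
  have := chi_mem_deg hv (2 * n + if s then 1 else 0)
  rwa [show 2 * (2 * n + if s then 1 else 0) + 1 = 4 * n + 2 + sg s by
    cases s <;> simp [sg] <;> ring] at this

theorem mode_mem_charge {c : ℤ} {v : Fock} (hv : v ∈ gr chargeWt c) (s : Bool) (n : ℤ) :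
    mode s n v ∈ gr chargeWt (c + sg s) := by
  have : mode s n v ∈ _ := chi_mem_gr hv (2 * n + if s then 1 else 0)
  rw [modeWt_chargeWt] at this
  cases s
  · simpa [sg, sub_eq_add_neg] using this
  · rw [if_neg (by simp)] at this
    simpa [sg] using this

/-- Induction along the recursion `smul_vp`; properties of the coefficients of `V⁺` are proved
without expanding the exponential. -/
theorem vp_induction {ε : ℂ} {p : ℤ → Fock → Prop} (u : Fock) (hneg : ∀ b, b < 0 → p b 0)
    (h0 : p 0 u)
    (hs : ∀ N : ℕ, (∀ b : ℤ, b ≤ N → p b (vp ε b u)) →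
      p (N + 1) ((ε / (N + 1 : ℂ)) •
        ∑ i ∈ Finset.range (N + 1), heis (-(i + 1 : ℤ)) (vp ε (N - i) u)))
    (b : ℤ) : p b (vp ε b u) := by
  have key : ∀ N : ℕ, ∀ b : ℤ, b ≤ N → p b (vp ε b u) := by
    intro N
    induction N with
    | zero =>
      intro b hb
      rcases lt_or_eq_of_le hb with h | h
      · rw [vp_of_neg ε (by simpa using h)]; exact hneg b (by simpa using h)
      · obtain rfl : b = 0 := by simpa using h
        rw [vp_zero]; exact h0
    | succ N ih =>
      intro b hb
      rcases lt_or_eq_of_le hb with h | h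
      · exact ih b (by push_cast at h; omega)
      · have h1 := smul_vp ε hb u
        have h2 := hs N ih
        rw [h] at h1 ⊢
        push_cast
        convert h2 using 1
        rw [div_eq_inv_mul, mul_smul, eq_inv_smul_iff₀ (Nat.cast_add_one_ne_zero N)]
        push_cast at h1
        rw [h1]
        simp only [show ∀ i : ℕ, (N : ℤ) + 1 - 1 - i = N - i by intro i; ring]
  exact key b.toNat b (Int.self_le_toNat b)

theorem vp_mem_deg {d : ℤ} {v : Fock} (hv : v ∈ gr degWt d) (ε : ℂ) (b : ℤ) :
    vp ε b v ∈ gr degWt (d + 4 * b) := by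
  refine vp_induction (p := fun b w => w ∈ gr degWt (d + 4 * b)) v
    (fun b _ => Submodule.zero_mem _) (by simpa using hv) ?_ b
  intro N ih
  refine Submodule.smul_mem _ _ (Submodule.sum_mem _ fun i hi => ?_)
  have := heis_mem_deg (ih (N - i) (by omega)) (-(i + 1))
  rwa [show d + 4 * ((N : ℤ) - i) - 4 * -(i + 1) = d + 4 * (N + 1) by ring] at this

theorem vp_mem_charge {c : ℤ} {v : Fock} (hv : v ∈ gr chargeWt c) (ε : ℂ) (b : ℤ) :
    vp ε b v ∈ gr chargeWt c :=
  vp_induction (p := fun _ w => w ∈ gr chargeWt c) v (fun b _ => Submodule.zero_mem _) hv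
    (fun N ih => Submodule.smul_mem _ _ (Submodule.sum_mem _ fun i _ =>
      heis_mem_charge (ih (N - i) (by omega)) _)) b

theorem vp_mem_of_stable {G : Submodule ℂ Fock} (hG : ∀ (i : ℕ), ∀ v ∈ G, heis (-(i + 1 : ℤ)) v ∈ G)
    {v : Fock} (hv : v ∈ G) (ε : ℂ) (b : ℤ) : vp ε b v ∈ G :=
  vp_induction (p := fun _ w => w ∈ G) v (fun b _ => Submodule.zero_mem _) hv
    (fun N ih => Submodule.smul_mem _ _ (Submodule.sum_mem _ fun i _ =>
      hG i _ (ih (N - i) (by omega)))) b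

theorem mkQ_vp (ε : ℂ) (b : ℤ) (u : Fock) :
    hNeg.mkQ (vp ε b u) = if b = 0 then hNeg.mkQ u else 0 := by
  refine vp_induction (p := fun b w => hNeg.mkQ w = if b = 0 then hNeg.mkQ u else 0) u
    (fun b hb => by rw [if_neg hb.ne, map_zero]) (by simp) ?_ b
  intro N ih
  rw [if_neg (by omega), map_smul, map_sum, Finset.sum_eq_zero fun i _ => mkQ_heis_neg i _,
    smul_zero]

/-- `h_k V⁺ = V⁺ (h_k - ε w^k)`, `k > 0`. -/
theorem heis_vp {k : ℤ} (hk : 0 < k) (ε : ℂ) (b : ℤ) (u : Fock) :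
    heis k (vp ε b u) = vp ε b (heis k u) - ε • vp ε (b - k) u := by
  have key : ∀ N : ℕ, ∀ b : ℤ, b ≤ N →
      heis k (vp ε b u) = vp ε b (heis k u) - ε • vp ε (b - k) u := by
    intro N
    induction N with
    | zero =>
      intro b hb
      rw [vp_of_neg ε (show b - k < 0 by omega)]
      rcases lt_or_eq_of_le hb with h | h
      · rw [vp_of_neg ε (by simpa using h)]; simp
      · obtain rfl : b = 0 := by simpa using h
        rw [vp_zero]; simp
    | succ N ih =>
      intro b hb
      rcases lt_or_eq_of_le hb with h | h
      · exact ih b (by push_cast at h; omega)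
      have hb0 : (b : ℂ) ≠ 0 := by rw [h]; exact Int.cast_ne_zero.2 (by omega)
      refine smul_right_injective Fock hb0 ?_
      change (b : ℂ) • _ = (b : ℂ) • _
      have h3 := smul_vp ε (show b - k ≤ (N + 1 : ℕ) by omega) u
      rw [← map_smul, smul_vp ε hb, smul_sub, smul_vp ε hb, map_smul, map_sum, smul_comm (b : ℂ) ε,
        ← smul_sub]
      congr 1
      -- Split `b` as `(b - k) + k`: the first part is the recursion at `b - k`, the second is
      -- matched by the single central term, at `i = k - 1`.
      rw [show (b : ℂ) = ((b - k : ℤ) : ℂ) + k by push_cast; ring, add_smul, h3]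
      have h4 : ∀ i ∈ Finset.range (N + 1), heis k (heis (-(i + 1 : ℤ)) (vp ε (b - 1 - i) u)) =
          heis (-(i + 1 : ℤ)) (vp ε (b - 1 - i) (heis k u)) -
          ε • heis (-(i + 1 : ℤ)) (vp ε (b - k - 1 - i) u) -
          if k + -(i + 1 : ℤ) = 0 then (k : ℂ) • vp ε (b - k) u else 0 := by
        intro i hi
        rw [heis_comm, ih _ (by push_cast at h; omega), map_sub, map_smul,
          show b - 1 - i - k = b - k - 1 - i by ring]
        congr 1
        by_cases h5 : k + -(i + 1 : ℤ) = 0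
        · rw [if_pos h5, if_pos h5, show b - 1 - i = b - k by omega]
        · rw [if_neg h5, if_neg h5]
      rw [Finset.sum_congr rfl h4, Finset.sum_sub_distrib, Finset.sum_sub_distrib, sub_sub,
        ← Finset.smul_sum]
      congr 2
      by_cases hkN : k ≤ (N + 1 : ℕ)
      · rw [Finset.sum_eq_single (k - 1).toNat]
        · rw [if_pos (by omega)]
        · intro i _ hi
          rw [if_neg (by omega)]
        · intro hi
          rw [Finset.mem_range] at hi
          omega
      · rw [vp_of_neg ε (show b - k < 0 by omega)]
        simp
  exact key b.toNat b (Int.self_le_toNat b)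

theorem mkQ_mode_heis_neg (s : Bool) (n : ℤ) (i : ℕ) (u : Fock) :
    hNeg.mkQ (mode s n (heis (-(i + 1 : ℤ)) u)) = -(sg s : ℂ) • hNeg.mkQ (mode s (n - 1 - i) u) := by
  rw [mode_heis, map_sub, mkQ_heis_neg, zero_sub, map_smul, neg_smul,
    show -(i + 1 : ℤ) + n = n - 1 - i by ring]

/-- Modulo `hNeg`, `x(z) V⁺(w)` is `(1 - w/z)⁻¹ x(z)` if the charges are opposite. -/
theorem mkQ_mode_vp_not (s : Bool) (n b : ℤ) (u : Fock) :
    hNeg.mkQ (mode (!s) n (vp (sg s) b u)) =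
      if 0 ≤ b then hNeg.mkQ (mode (!s) (n - b) u) else 0 := by
  revert n
  refine vp_induction (p := fun b w => ∀ n, hNeg.mkQ (mode (!s) n w) =
    if 0 ≤ b then hNeg.mkQ (mode (!s) (n - b) u) else 0) u
    (fun b hb n => by rw [if_neg (by omega), map_zero, map_zero]) (fun n => by simp) ?_ b
  intro N ih n
  rw [if_pos (by omega), map_smul, map_smul, map_sum, map_sum, Finset.sum_congr rfl (fun i hi => by
    rw [mkQ_mode_heis_neg, ih (N - i) (by omega), if_pos (by rw [Finset.mem_range] at hi; omega),
      show n - 1 - i - (N - i) = n - (N + 1) by ring]), Finset.sum_const, Finset.card_range,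
    ← Nat.cast_smul_eq_nsmul ℂ, smul_smul, smul_smul, sg_not]
  have h1 : ((sg s : ℤ) : ℂ) * (sg s : ℤ) = 1 := by exact_mod_cast sg_mul_sg s
  have h2 : (N + 1 : ℂ) ≠ 0 := Nat.cast_add_one_ne_zero N
  -- The `N + 1` summands coincide, which cancels the denominator, and the two signs multiply to
  -- `1`.
  convert one_smul ℂ _ using 2
  push_cast
  field_simp
  linear_combination h1

/-- Modulo `hNeg`, `x(z) V⁺(w)` is `(1 - w/z) x(z)` if the charges are equal. -/
theorem mkQ_mode_vp_self (s : Bool) (n b : ℤ) (u : Fock) :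
    hNeg.mkQ (mode s n (vp (sg s) b u)) = (if b = 0 then hNeg.mkQ (mode s n u) else 0) -
      if b = 1 then hNeg.mkQ (mode s (n - 1) u) else 0 := by
  revert n
  refine vp_induction (p := fun b w => ∀ n, hNeg.mkQ (mode s n w) =
    (if b = 0 then hNeg.mkQ (mode s n u) else 0) -
      if b = 1 then hNeg.mkQ (mode s (n - 1) u) else 0) u
    (fun b hb n => by rw [if_neg (by omega), if_neg (by omega), map_zero, map_zero, sub_zero])
    (fun n => by simp) ?_ b
  intro N ih n
  rw [if_neg (by omega), zero_sub, map_smul, map_smul, map_sum, map_sum,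
    Finset.sum_congr rfl (fun i hi => by rw [mkQ_mode_heis_neg, ih (N - i) (by omega)]),
    ← Finset.smul_sum, Finset.sum_sub_distrib, smul_smul]
  have h1 : ((sg s : ℤ) : ℂ) * (sg s : ℤ) = 1 := by exact_mod_cast sg_mul_sg s
  rw [Finset.sum_eq_single N (fun i _ hi => if_neg (by omega)) (by simp), if_pos (by omega)]
  -- The two surviving terms, `i = N` and `i = N - 1`, cancel each other unless `N = 0`, where only
  -- the first exists.
  rcases Nat.eq_zero_or_pos N with rfl | hN
  · rw [Finset.sum_eq_zero (fun i hi => if_neg (by rw [Finset.mem_range] at hi; omega)),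
      if_pos (by simp), sub_zero, ← neg_one_smul ℂ (hNeg.mkQ _)]
    congr 1
    · push_cast
      linear_combination -h1
    · simp
  · rw [Finset.sum_eq_single (N - 1) (fun i _ hi => if_neg (by omega))
      (fun h => absurd (Finset.mem_range.2 (by omega)) h), if_pos (by omega), if_neg (by omega),
      show n - 1 - ((N - 1 : ℕ) : ℤ) - 1 = n - 1 - N by omega, sub_self, smul_zero, neg_zero]

theorem finsum_comp_of_injective {ι κ A : Type*} [AddCommMonoid A] {g : ι → κ}
    (hg : Function.Injective g) {f : κ → A} (hf : ∀ x, x ∉ Set.range g → f x = 0) :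
    ∑ᶠ x, f x = ∑ᶠ i, f (g i) := by
  classical
  rw [← finsum_mem_range hg]
  refine finsum_congr fun x => ?_
  by_cases hx : x ∈ Set.range g
  · rw [finsum_eq_if, if_pos hx]
  · rw [finsum_eq_if, if_neg hx, hf x hx]

theorem mkQ_finsum {ι : Type*} {f : ι → Fock} (hf : f.support.Finite) :
    hNeg.mkQ (∑ᶠ i, f i) = ∑ᶠ i, hNeg.mkQ (f i) :=
  hNeg.mkQ.toAddMonoidHom.map_finsum hf

/-! ### The annihilating exponential -/

section Lowering

/-- The coefficient of `w^{-a}` lowers the degree by `2a` (so `degWt` by `4a`). -/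
def LowersDegree (f : PowerSeries (Module.End ℂ Fock)) : Prop :=
  ∀ (a : ℕ) (d : ℤ), ∀ v ∈ gr degWt d, PowerSeries.coeff a f v ∈ gr degWt (d - 4 * a)

theorem LowersDegree.pow {f : PowerSeries (Module.End ℂ Fock)} (hf : LowersDegree f) (k : ℕ) :
    LowersDegree (f ^ k) := by
  induction k with
  | zero =>
    intro a d v hv
    rw [pow_zero, PowerSeries.coeff_one]
    split_ifs with h
    · simpa [h] using hv
    · exact Submodule.zero_mem _
  | succ k ih =>
    intro a d v hv
    rw [pow_succ, PowerSeries.coeff_mul, LinearMap.sum_apply]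
    refine Submodule.sum_mem _ fun x hx => ?_
    rw [Finset.HasAntidiagonal.mem_antidiagonal] at hx
    have := ih x.1 _ _ (hf x.2 d v hv)
    rwa [show d - 4 * (x.2 : ℤ) - 4 * x.1 = d - 4 * a by omega] at this

theorem lowersDegree_Vminus (ε : ℂ) : LowersDegree (Vminus ε) := by
  intro a d v hv
  rw [Vminus, opExp, PowerSeries.coeff_mk, LinearMap.sum_apply]
  refine Submodule.sum_mem _ fun k _ => Submodule.smul_mem _ _ (LowersDegree.pow ?_ k a d v hv)
  intro a d v hv
  rw [PowerSeries.coeff_mk]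
  split_ifs
  · exact Submodule.zero_mem _
  · exact Submodule.smul_mem _ _ (heis_mem_deg hv a)

theorem exists_Vminus_eq_zero (ε : ℂ) (v : Fock) :
    ∃ A : ℕ, ∀ a, A ≤ a → PowerSeries.coeff a (Vminus ε) v = 0 := by
  refine span_homogeneous_induction degWt
    (p := fun v => ∃ A : ℕ, ∀ a, A ≤ a → PowerSeries.coeff a (Vminus ε) v = 0)
    ⟨0, fun j _ => map_zero _⟩ ?_ ?_ v
  · rintro u v ⟨N, hN⟩ ⟨N', hN'⟩
    refine ⟨max N N', fun j hj => ?_⟩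
    rw [map_add, hN j ((le_max_left _ _).trans hj), hN' j ((le_max_right _ _).trans hj), add_zero]
  · intro d v hv
    refine ⟨d.toNat + 1, fun j hj => gr_deg_neg ?_ (lowersDegree_Vminus ε j d v hv)⟩
    omega

/-- Every nonconstant term of the annihilating exponential has some `h_n`, `n > 0`, acting first. -/
theorem Vminus_apply_of_mem {v : Fock} (hv : v ∈ vacuumSpace) (ε : ℂ) (a : ℕ) :
    PowerSeries.coeff a (Vminus ε) v = if a = 0 then v else 0 := by
  split_ifs with ha
  · rw [ha, Vminus, coeff_zero_opExp (by simp)]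
    rfl
  · rw [Vminus, opExp, PowerSeries.coeff_mk, LinearMap.sum_apply]
    refine Finset.sum_eq_zero fun k _ => ?_
    rw [LinearMap.smul_apply]
    rcases k with _ | k
    · rw [pow_zero, PowerSeries.coeff_one, if_neg ha]; simp
    · rw [pow_succ, PowerSeries.coeff_mul, LinearMap.sum_apply, Finset.sum_eq_zero, smul_zero]
      intro x _
      rw [Module.End.mul_apply, PowerSeries.coeff_mk]
      split_ifs with h
      · simp
      · rw [LinearMap.smul_apply, mem_vacuumSpace.1 hv _ (by omega)]; simp

theorem chargeProj_finite (v : Fock) : (Function.support fun c => chargeProj c v).Finite := by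
  refine span_homogeneous_induction chargeWt
    (p := fun v => (Function.support fun c => chargeProj c v).Finite) (by simp) ?_ ?_ v
  · intro u v hu hv
    refine (hu.union hv).subset fun c hc => ?_
    by_contra h
    simp only [Set.mem_union, Function.mem_support, not_or, not_not] at h
    exact hc (by simp [h.1, h.2])
  · intro c v hv
    refine (Set.finite_singleton c).subset fun c' hc' => ?_
    by_contra h
    exact hc' ((chargeProj_apply hv c').trans (if_neg h))

end Lowering

/-! ### The modes of `H^β` and `H^γ` -/

/-- The modes of `H^γ` (`true`) and `H^β` (`false`). -/
def Hmode (s : Bool) (n : ℤ) : Module.End ℂ Fock :=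
  locSum fun x : ℕ × ℤ × ℕ =>
    PowerSeries.coeff x.1 (Vplus (sg s)) * mode s (n + x.1 + sg s * x.2.1 - x.2.2) *
      chargeProj x.2.1 * PowerSeries.coeff x.2.2 (Vminus (sg s))

theorem Hmode_false (n : ℤ) : Hmode false n = Hbeta n := by
  simp only [Hmode, Hbeta, mode_false]
  congr 1
  funext x
  simp [sg, sub_eq_add_neg]

theorem Hmode_true (n : ℤ) : Hmode true n = Hgamma n := by
  simp only [Hmode, Hgamma, mode_true]
  congr 1
  funext x
  simp [sg]

/-- Degree bounds the power of `w⁻¹` from `V⁻`, each resulting vector has finitely many charges, and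
for each of these high modes vanish, which bounds the power of `w` from `V⁺`. -/
theorem Hmode_finite (s : Bool) (n : ℤ) (v : Fock) : (Function.support fun x : ℕ × ℤ × ℕ =>
    (PowerSeries.coeff x.1 (Vplus (sg s)) * mode s (n + x.1 + sg s * x.2.1 - x.2.2) *
      chargeProj x.2.1 * PowerSeries.coeff x.2.2 (Vminus (sg s))) v).Finite := by
  obtain ⟨A, hA⟩ := exists_Vminus_eq_zero (sg s) v
  have h1 : (⋃ a ∈ Finset.range A, ⋃ c ∈ (chargeProj_finite
      (PowerSeries.coeff a (Vminus (sg s)) v)).toFinset,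
      {x : ℕ × ℤ × ℕ | x.2 = (c, a) ∧ (x.1 : ℤ) ≤ (exists_mode_eq_zero
        (chargeProj c (PowerSeries.coeff a (Vminus (sg s)) v))).choose - n - sg s * c + a}).Finite := by
    refine Set.Finite.biUnion (Finset.finite_toSet _) fun a _ =>
      Set.Finite.biUnion (Finset.finite_toSet _) fun c _ => ?_
    obtain ⟨D, hD⟩ : ∃ D : ℤ, D = (exists_mode_eq_zero
      (chargeProj c (PowerSeries.coeff a (Vminus (sg s)) v))).choose - n - sg s * c + a := ⟨_, rfl⟩
    rw [← hD]
    refine ((Set.finite_Iic D.toNat).image fun b : ℕ => (b, c, a)).subset ?_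
    rintro ⟨b, _⟩ ⟨rfl, hb⟩
    exact ⟨b, by simp only [Set.mem_Iic] at *; omega, rfl⟩
  refine h1.subset ?_
  rintro ⟨b, c, a⟩ hx
  simp only [Function.mem_support, Module.End.mul_apply] at hx
  simp only [Set.mem_iUnion, Finset.mem_range, Set.Finite.mem_toFinset, Function.mem_support]
  refine ⟨a, ?_, c, ?_, rfl, ?_⟩
  · by_contra h
    exact hx (by rw [hA a (by omega)]; simp)
  · intro h
    exact hx (by rw [h]; simp)
  · by_contra h
    refine hx ?_
    rw [(exists_mode_eq_zero (chargeProj c (PowerSeries.coeff a (Vminus (sg s)) v))).choose_spec,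
      map_zero]
    simp only at h
    omega

variable {c : ℤ} {v : Fock}

theorem vp_mode_finite (ε : ℂ) (s : Bool) (n : ℤ) (v : Fock) :
    (Function.support fun b : ℤ => vp ε b (mode s (n + b) v)).Finite := by
  obtain ⟨D, hD⟩ := exists_mode_eq_zero v
  refine (Set.finite_Icc 0 (D - n)).subset fun b hb => ?_
  by_contra h
  refine hb ?_
  simp only [Set.mem_Icc, not_and_or, not_le] at h
  rcases h with h | h
  · simp only [vp_of_neg ε h, LinearMap.zero_apply]
  · simp only [hD s (n + b) (by omega), map_zero]

/-- On a vacuum vector of charge `c` the factor `V⁻` is the identity and `w^{±h_0}` is a shift of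
the index, so a single sum remains. -/
theorem Hmode_apply (hv : v ∈ vacuumSpace) (hc : v ∈ gr chargeWt c) (s : Bool) (n : ℤ) :
    Hmode s n v = ∑ᶠ b : ℤ, vp (sg s) b (mode s (n + sg s * c + b) v) := by
  rw [Hmode, locSum_apply _ (Hmode_finite s n),
    finsum_comp_of_injective (g := fun b : ℕ => (b, c, 0))
      (fun a b h => by simpa using h),
    finsum_comp_of_injective (g := fun b : ℕ => (b : ℤ)) Nat.cast_injective]
  · refine finsum_congr fun b => ?_
    simp only [Module.End.mul_apply, vp_natCast]
    rw [Vminus_apply_of_mem hv, if_pos rfl, chargeProj_apply hc, if_pos rfl,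
      show n + (b : ℤ) + sg s * c - (0 : ℕ) = n + sg s * c + b by push_cast; ring]
  · intro b hb
    rw [vp_of_neg, LinearMap.zero_apply]
    by_contra h
    exact hb ⟨b.toNat, by simp only; omega⟩
  · rintro ⟨b, c', a⟩ hx
    simp only [Module.End.mul_apply]
    rw [Vminus_apply_of_mem hv]
    by_cases ha : a = 0
    · rw [if_pos ha, chargeProj_apply hc, if_neg]
      · simp
      · rintro rfl
        exact hx ⟨b, by rw [ha]⟩
    · rw [if_neg ha]; simp

/-- Commuting `h_k` past the mode raises its index by `k`; commuting it past `V⁺` lowers the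
exponent `b` by `k`. The two resulting sums are the same up to reindexing and have opposite signs.
-/
theorem Hmode_mem_vacuumSpace (hv : v ∈ vacuumSpace) (hc : v ∈ gr chargeWt c) (s : Bool) (n : ℤ) :
    Hmode s n v ∈ vacuumSpace := by
  rw [mem_vacuumSpace]
  intro k hk
  rw [Hmode_apply hv hc, map_finsum_of_finite _ (vp_mode_finite _ s _ v)]
  have h1 : ∀ b : ℤ, heis k (vp (sg s) b (mode s (n + sg s * c + b) v)) =
      (sg s : ℂ) • vp (sg s) b (mode s (n + sg s * c + k + b) v) -
      (sg s : ℂ) • vp (sg s) (b - k) (mode s (n + sg s * c + k + (b - k)) v) := by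
    intro b
    rw [heis_vp hk, heis_mode, mem_vacuumSpace.1 hv k hk, map_zero, zero_add, map_smul,
      show k + (n + sg s * c + b) = n + sg s * c + k + b by ring,
      show n + sg s * c + k + (b - k) = n + sg s * c + b by ring]
  have h2 : (Function.support fun b : ℤ =>
      (sg s : ℂ) • vp (sg s) b (mode s (n + sg s * c + k + b) v)).Finite :=
    (vp_mode_finite (sg s) s (n + sg s * c + k) v).subset fun b hb h => hb (by simp only [h, smul_zero])
  simp_rw [h1]
  rw [finsum_sub_distrib h2, sub_eq_zero]
  · exact (finsum_comp_equiv (Equiv.subRight k) (f := fun b : ℤ =>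
      (sg s : ℂ) • vp (sg s) b (mode s (n + sg s * c + k + b) v))).symm
  · exact (h2.preimage (f := fun b : ℤ => b - k) (sub_left_injective.injOn)).subset fun b hb => hb

theorem Hmode_mem_charge (hv : v ∈ vacuumSpace) (hc : v ∈ gr chargeWt c) (s : Bool) (n : ℤ) :
    Hmode s n v ∈ gr chargeWt (c + sg s) := by
  rw [Hmode_apply hv hc]
  exact finsum_mem_submodule _ fun b => vp_mem_charge (mode_mem_charge hc s _) _ _

theorem Hmode_mem_deg {d : ℤ} (hv : v ∈ vacuumSpace) (hc : v ∈ gr chargeWt c)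
    (hd : v ∈ gr degWt d) (s : Bool) (n : ℤ) :
    Hmode s n v ∈ gr degWt (d - (4 * n + 4 * sg s * c + 2 + sg s)) := by
  rw [Hmode_apply hv hc]
  refine finsum_mem_submodule _ fun b => ?_
  have := vp_mem_deg (mode_mem_deg hd s (n + sg s * c + b)) (sg s) b
  rwa [show d - (4 * (n + sg s * c + b) + 2 + sg s) + 4 * b =
    d - (4 * n + 4 * sg s * c + 2 + sg s) by ring] at this

theorem mkQ_Hmode (hv : v ∈ vacuumSpace) (hc : v ∈ gr chargeWt c) (s : Bool) (n : ℤ) :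
    hNeg.mkQ (Hmode s n v) = hNeg.mkQ (mode s (n + sg s * c) v) := by
  rw [Hmode_apply hv hc, mkQ_finsum (vp_mode_finite _ s _ v), finsum_eq_single _ 0]
  · rw [mkQ_vp, if_pos rfl, add_zero]
  · intro b hb
    rw [mkQ_vp, if_neg hb]

/-- The inner `V⁺` contributes the factor `1 - w/z`. The extra `1` in the index of the outer mode
arises because the inner mode has changed the charge by `sg s`. -/
theorem mkQ_Hmode_Hmode_self (hv : v ∈ vacuumSpace) (hc : v ∈ gr chargeWt c) (s : Bool) (m n : ℤ) :
    hNeg.mkQ (Hmode s m (Hmode s n v)) =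
      hNeg.mkQ (mode s (m + sg s * c + 1) (mode s (n + sg s * c) v)) -
      hNeg.mkQ (mode s (m + sg s * c) (mode s (n + sg s * c + 1) v)) := by
  rw [mkQ_Hmode (Hmode_mem_vacuumSpace hv hc s n) (Hmode_mem_charge hv hc s n), mul_add, sg_mul_sg,
    ← add_assoc, Hmode_apply hv hc, map_finsum_of_finite _ (vp_mode_finite _ s _ v), mkQ_finsum]
  · simp_rw [mkQ_mode_vp_self]
    rw [finsum_sub_distrib]
    · rw [finsum_eq_single _ 0 (fun b hb => if_neg hb), finsum_eq_single _ 1 (fun b hb => if_neg hb),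
        if_pos rfl, if_pos rfl, add_zero, add_sub_cancel_right]
    · exact (Set.finite_singleton 0).subset fun b hb => by by_contra h; exact hb (if_neg h)
    · exact (Set.finite_singleton 1).subset fun b hb => by by_contra h; exact hb (if_neg h)
  · exact (vp_mode_finite (sg s) s (n + sg s * c) v).subset fun b hb h =>
      hb (by simp only at h ⊢; rw [h, map_zero])

/-- Modes of one field commute, so the two-term expression modulo `hNeg` is antisymmetric in `m` and
`n`. -/
theorem Hmode_anticomm_self (hv : v ∈ vacuumSpace) (hc : v ∈ gr chargeWt c) (s : Bool) (m n : ℤ) :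
    Hmode s m (Hmode s n v) = -Hmode s n (Hmode s m v) := by
  have h1 := fun m => Hmode_mem_vacuumSpace hv hc s m
  have h2 := fun m => Hmode_mem_charge hv hc s m
  refine eq_of_mkQ_eq (Hmode_mem_vacuumSpace (h1 n) (h2 n) s m)
    (Submodule.neg_mem _ (Hmode_mem_vacuumSpace (h1 m) (h2 m) s n)) ?_
  rw [map_neg, mkQ_Hmode_Hmode_self hv hc, mkQ_Hmode_Hmode_self hv hc,
    mode_comm_self s (m + sg s * c + 1), mode_comm_self s (m + sg s * c), neg_sub]

/-- For opposite charges the inner `V⁺` contributes the geometric series `(1 - w/z)⁻¹`, hence a sum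
over `b ≥ 0`. -/
theorem mkQ_Hmode_Hmode_not (hv : v ∈ vacuumSpace) (hc : v ∈ gr chargeWt c) (s : Bool) (m n : ℤ) :
    hNeg.mkQ (Hmode (!s) m (Hmode s n v)) = ∑ᶠ b : ℤ, if 0 ≤ b then
      hNeg.mkQ (mode (!s) (m - sg s * c - 1 - b) (mode s (n + sg s * c + b) v)) else 0 := by
  rw [mkQ_Hmode (Hmode_mem_vacuumSpace hv hc s n) (Hmode_mem_charge hv hc s n), sg_not,
    Hmode_apply hv hc, map_finsum_of_finite _ (vp_mode_finite _ s _ v), mkQ_finsum]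
  · refine finsum_congr fun b => ?_
    rw [mkQ_mode_vp_not, show m + -sg s * (c + sg s) - b = m - sg s * c - sg s * sg s - b by ring,
      sg_mul_sg]
  · exact (vp_mode_finite (sg s) s (n + sg s * c) v).subset fun b hb h =>
      hb (by simp only at h ⊢; rw [h, map_zero])

theorem heis_apply_mode (n : ℤ) (v : Fock) : heis n v =
    ∑ᶠ i : ℤ, normalOrd (2 * i) (2 * (n - 1 - i) + 1) v := by
  have hfin := half_normalOrd_finite n v
  have h1 : ∀ i : ℤ, (1 / 2 : ℂ) • normalOrd i (2 * n - 1 - i) v =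
      (if Even i then (1 / 2 : ℂ) • normalOrd i (2 * n - 1 - i) v else 0) +
      (if Even (2 * n - 1 - i) then (1 / 2 : ℂ) • normalOrd i (2 * n - 1 - i) v else 0) := by
    intro i
    by_cases h : Even i
    · rw [if_pos h, if_neg, add_zero]
      rintro ⟨k, hk⟩
      obtain ⟨l, hl⟩ := h
      omega
    · rw [if_neg h, if_pos, zero_add]
      rw [Int.not_even_iff_odd] at h
      obtain ⟨l, hl⟩ := h
      exact ⟨n - 1 - l, by omega⟩
  rw [heis_apply, finsum_congr h1, finsum_add_distrib]
  · have h2 := finsum_comp_equiv (Equiv.subLeft (2 * n - 1)) (f := fun i : ℤ =>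
      if Even i then (1 / 2 : ℂ) • normalOrd i (2 * n - 1 - i) v else 0)
    simp only [Equiv.subLeft_apply, sub_sub_cancel] at h2
    simp only [normalOrd_comm (2 * n - 1 - _)] at h2
    rw [h2, ← two_smul ℂ, smul_finsum' _]
    · rw [finsum_comp_of_injective (g := fun i : ℤ => 2 * i)
        (fun a b h => by simpa using h)]
      · refine finsum_congr fun i => ?_
        rw [if_pos (even_two_mul i), smul_smul,
          show 2 * n - 1 - 2 * i = 2 * (n - 1 - i) + 1 by ring]
        norm_num
      · intro i hi
        rw [if_neg, smul_zero]
        rintro ⟨k, hk⟩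
        exact hi ⟨k, by simp only; omega⟩
    · exact hfin.subset fun i hi h => hi (by simp only [h, ite_self])
  · exact hfin.subset fun i hi h => hi (by simp only [h, ite_self])
  · exact hfin.subset fun i hi h => hi (by simp only [h, ite_self])

theorem finsum_ite_Ico (M : ℤ) (v : Fock) :
    (∑ᶠ i : ℤ, ((if 0 ≤ i ∧ i < M then v else 0) - if M ≤ i ∧ i < 0 then v else 0)) =
      (M : ℂ) • v := by
  rw [finsum_sub_distrib, finsum_eq_sum_of_support_subset (s := Finset.Ico 0 M),
    finsum_eq_sum_of_support_subset (s := Finset.Ico M 0)]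
  · simp only [← Finset.mem_Ico]
    rw [Finset.sum_ite_mem, Finset.sum_ite_mem, Finset.inter_self, Finset.inter_self,
      Finset.sum_const, Finset.sum_const, Int.card_Ico, Int.card_Ico, ← Nat.cast_smul_eq_nsmul ℂ,
      ← Nat.cast_smul_eq_nsmul ℂ, ← sub_smul]
    congr 1
    have : (((M - 0).toNat : ℤ) : ℂ) - (((0 - M).toNat : ℤ) : ℂ) = M := by
      rw [← Int.cast_sub]; congr 1; omega
    exact_mod_cast this
  · intro i hi; by_contra h; exact hi (if_neg (by simpa using h))
  · intro i hi; by_contra h; exact hi (if_neg (by simpa using h))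
  · refine (Set.finite_Ico 0 M).subset ?_
    intro i hi; by_contra h; exact hi (if_neg (by simpa using h))
  · refine (Set.finite_Ico M 0).subset ?_
    intro i hi; by_contra h; exact hi (if_neg (by simpa using h))

theorem mode_mode_finite (s t : Bool) (M N : ℤ) (v : Fock) :
    (Function.support fun b : ℤ =>
      if 0 ≤ b then mode s (M - b) (mode t (N + b) v) else 0).Finite := by
  obtain ⟨D, hD⟩ := exists_mode_eq_zero v
  refine (Set.finite_Icc 0 (D - N)).subset fun b hb => ?_
  by_contra h
  refine hb ?_
  simp only [Set.mem_Icc, not_and_or, not_le] at h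
  simp only
  rcases h with h | h
  · rw [if_neg (by omega)]
  · rw [hD t (N + b) (by omega), map_zero, ite_self]

/-- The Heisenberg modes as sums of products of modes ordered at an arbitrary place. -/
theorem finsum_mode_mode (M N : ℤ) (v : Fock) :
    (∑ᶠ b : ℤ, if 0 ≤ b then mode false (M - 1 - b) (mode true (N + b) v) else 0) +
    (∑ᶠ b : ℤ, if 0 ≤ b then mode true (N - 1 - b) (mode false (M + b) v) else 0) =
      heis (M + N) v + if M + N = 0 then (M : ℂ) • v else 0 := by
  rw [← finsum_comp_equiv (Equiv.subLeft (M - 1)), ← finsum_comp_equiv (Equiv.subRight M)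
    (f := fun b => if 0 ≤ b then mode true (N - 1 - b) (mode false (M + b) v) else 0)]
  simp only [Equiv.subLeft_apply, Equiv.subRight_apply, sub_sub_cancel, add_sub_cancel]
  rw [← finsum_add_distrib, heis_apply_mode]
  · have h1 : (if M + N = 0 then (M : ℂ) • v else 0) = ∑ᶠ i : ℤ,
        ((if 0 ≤ i ∧ i < M then (if M + N = 0 then v else 0) else 0) -
          if M ≤ i ∧ i < 0 then (if M + N = 0 then v else 0) else 0) := by
      rw [finsum_ite_Ico]
      split_ifs <;> simp
    rw [h1, ← finsum_add_distrib]
    · refine finsum_congr fun i => ?_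
      have h2 := mode_false_mode_true i (M + N - 1 - i) v
      simp only [show i + (M + N - 1 - i) + 1 = M + N by ring] at h2
      have h3 : normalOrd (2 * i) (2 * (M + N - 1 - i) + 1) v =
          if 0 ≤ i then mode true (M + N - 1 - i) (mode false i v)
            else mode false i (mode true (M + N - 1 - i) v) := by
        unfold normalOrd mode
        by_cases h : 0 ≤ i
        · rw [if_pos (by omega), if_pos h]; simp
        · rw [if_neg (by omega), if_neg h]; simp
      rw [h3, show N + (M - 1 - i) = M + N - 1 - i by ring,
        show N - 1 - (i - M) = M + N - 1 - i by ring]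
      by_cases a1 : 0 ≤ i <;> by_cases a2 : i < M
      · rw [if_pos (show 0 ≤ M - 1 - i by omega), if_neg (show ¬ 0 ≤ i - M by omega), if_pos a1,
          if_pos ⟨a1, a2⟩, if_neg (show ¬ (M ≤ i ∧ i < 0) by omega), h2, add_zero, sub_zero]
      · rw [if_neg (show ¬ 0 ≤ M - 1 - i by omega), if_pos (show 0 ≤ i - M by omega), if_pos a1,
          if_neg (show ¬ (0 ≤ i ∧ i < M) by omega), if_neg (show ¬ (M ≤ i ∧ i < 0) by omega)]
        simp
      · rw [if_pos (show 0 ≤ M - 1 - i by omega), if_neg (show ¬ 0 ≤ i - M by omega), if_neg a1,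
          if_neg (show ¬ (0 ≤ i ∧ i < M) by omega), if_neg (show ¬ (M ≤ i ∧ i < 0) by omega)]
        simp
      · rw [if_neg (show ¬ 0 ≤ M - 1 - i by omega), if_pos (show 0 ≤ i - M by omega), if_neg a1,
          if_neg (show ¬ (0 ≤ i ∧ i < M) by omega), if_pos (show M ≤ i ∧ i < 0 by omega), h2]
        abel
    · refine (((normalOrd_finite (2 * (M + N) - 1) v)).preimage (f := fun i : ℤ => 2 * i)
        (fun a _ b _ h => by simpa using h)).subset fun i hi h => hi ?_
      simp only at h ⊢
      rwa [show 2 * (M + N - 1 - i) + 1 = 2 * (M + N) - 1 - 2 * i by ring]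
    · refine ((Set.finite_Ico 0 M).union (Set.finite_Ico M 0)).subset fun i hi => ?_
      by_contra h
      simp only [Set.mem_union, Set.mem_Ico, not_or] at h
      exact hi (by simp only [if_neg h.1, if_neg h.2, sub_zero])
  · refine ((mode_mode_finite false true (M - 1) N v).preimage (f := fun i : ℤ => M - 1 - i)
      (sub_right_injective.injOn)).subset fun i hi h => hi ?_
    simpa using h
  · refine ((mode_mode_finite true false (N - 1) M v).preimage (f := fun i : ℤ => i - M)
      (sub_left_injective.injOn)).subset fun i hi h => hi ?_
    simpa using h

/-- `{H^β_m, H^γ_n} = m δ_{m+n,0}` on the vacuum space. -/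
theorem Hmode_false_true (hv : v ∈ vacuumSpace) (hc : v ∈ gr chargeWt c) (m n : ℤ) :
    Hmode false m (Hmode true n v) + Hmode true n (Hmode false m v) =
      if m + n = 0 then (m : ℂ) • v else 0 := by
  have h1 := fun s m => Hmode_mem_vacuumSpace hv hc s m
  have h2 := fun s m => Hmode_mem_charge hv hc s m
  refine eq_of_mkQ_eq (Submodule.add_mem _ (Hmode_mem_vacuumSpace (h1 _ _) (h2 _ _) _ _)
    (Hmode_mem_vacuumSpace (h1 _ _) (h2 _ _) _ _)) ?_ ?_
  · split_ifs
    · exact Submodule.smul_mem _ _ hv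
    · exact Submodule.zero_mem _
  have e1 := mkQ_Hmode_Hmode_not hv hc true m n
  have e2 := mkQ_Hmode_Hmode_not hv hc false n m
  -- The charge shifts in the two geometric series become the cutting points `m - c` and `n + c`.
  have h3 := congrArg hNeg.mkQ (finsum_mode_mode (m - c) (n + c) v)
  rw [map_add, mkQ_finsum (mode_mode_finite _ _ _ _ _), mkQ_finsum (mode_mode_finite _ _ _ _ _)] at h3
  simp only [sg, Bool.not_true, Bool.not_false, if_true, Bool.false_eq_true, if_false, one_mul,
    neg_mul, sub_neg_eq_add, ← sub_eq_add_neg] at e1 e2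
  simp only [apply_ite hNeg.mkQ, map_zero] at h3
  rw [map_add, e1, e2]
  refine h3.trans ?_
  rw [show m - c + (n + c) = m + n by ring, map_add]
  -- The remaining `h_{m+n} v` lies in `hNeg` for negative index and is zero for positive index. For
  -- index `0` it is `c v`, and `(m - c) + c = m`.
  rcases lt_trichotomy (m + n) 0 with h | h | h
  · rw [if_neg h.ne, if_neg h.ne, mkQ_heis_of_neg h, map_zero, add_zero]
  · rw [if_pos h, if_pos h, h, heis_zero_apply hc, ← map_add, ← add_smul]
    congr 2
    push_cast
    ring
  · rw [if_neg h.ne', if_neg h.ne', mem_vacuumSpace.1 hv _ h, map_zero, add_zero]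

/-! ### Words in the creation modes -/

/-- The vector `H_{i_1} ⋯ H_{i_k}|0⟩`, where `(s, m)` stands for the mode with index `-m`. -/
def word (l : List (Bool × ℕ+)) : Fock :=
  (l.map fun i => Hmode i.1 (-((i.2 : ℕ) : ℤ))).prod 1

theorem word_nil : word [] = 1 := rfl

theorem word_cons (i : Bool × ℕ+) (l : List (Bool × ℕ+)) :
    word (i :: l) = Hmode i.1 (-((i.2 : ℕ) : ℤ)) (word l) := by
  simp [word]

theorem one_mem_vacuumSpace : (1 : Fock) ∈ vacuumSpace :=
  mem_vacuumSpace.2 fun _ hn => heis_one hn.le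

theorem word_mem (l : List (Bool × ℕ+)) :
    word l ∈ vacuumSpace ∧ ∃ c, word l ∈ gr chargeWt c := by
  induction l with
  | nil => exact ⟨one_mem_vacuumSpace, 0, one_mem_gr _⟩
  | cons i l ih =>
    obtain ⟨h1, c, h2⟩ := ih
    rw [word_cons]
    exact ⟨Hmode_mem_vacuumSpace h1 h2 _ _, _, Hmode_mem_charge h1 h2 _ _⟩

theorem Hmode_anticomm {c : ℤ} {v : Fock} (hv : v ∈ vacuumSpace) (hc : v ∈ gr chargeWt c)
    (s t : Bool) (m n : ℤ) : Hmode s m (Hmode t n v) = -Hmode t n (Hmode s m v) +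
      if t = !s ∧ m + n = 0 then (-(sg s : ℂ) * m) • v else 0 := by
  have h1 := Hmode_anticomm_self hv hc s m n
  cases s <;> cases t <;> simp only [Bool.not_true, Bool.not_false, true_and, Bool.true_eq_false,
    Bool.false_eq_true, false_and, if_false, add_zero]
  · exact h1
  · rw [neg_add_eq_sub, eq_sub_iff_add_eq, Hmode_false_true hv hc]
    simp [sg]
  · rw [neg_add_eq_sub, eq_sub_iff_add_eq, add_comm, Hmode_false_true hv hc, add_comm n m]
    by_cases h : m + n = 0
    · obtain rfl : n = -m := by omega
      simp [sg]
    · rw [if_neg h, if_neg h]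
  · exact h1

/-- Both indices are strictly negative, so the central term is absent and creation modes
anticommute. -/
theorem word_swap (i j : Bool × ℕ+) (l : List (Bool × ℕ+)) :
    word (i :: j :: l) = -word (j :: i :: l) := by
  obtain ⟨h1, c, h2⟩ := word_mem l
  simp only [word_cons]
  rw [Hmode_anticomm h1 h2, if_neg, add_zero]
  have := i.2.pos
  have := j.2.pos
  omega

theorem word_perm {l l' : List (Bool × ℕ+)} (h : l.Perm l') :
    word l = word l' ∨ word l = -word l' := by
  induction h with
  | nil => exact Or.inl rfl
  | cons i _ ih =>
    rw [word_cons, word_cons]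
    rcases ih with h | h
    · exact Or.inl (by rw [h])
    · exact Or.inr (by rw [h, map_neg])
  | swap i j l => exact Or.inr (word_swap j i l)
  | trans _ _ h1 h2 =>
    rcases h1 with h1 | h1 <;> rcases h2 with h2 | h2 <;> rw [h1, h2] <;> simp

theorem word_eq_zero_of_not_nodup {l : List (Bool × ℕ+)} (h : ¬ l.Nodup) : word l = 0 := by
  induction l with
  | nil => exact absurd List.nodup_nil h
  | cons i l ih =>
    by_cases hl : l.Nodup
    · have hi : i ∈ l := by
        by_contra hi
        exact h (List.nodup_cons.2 ⟨hi, hl⟩)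
      have h1 := word_swap i i (l.erase i)
      have h2 : word (i :: i :: l.erase i) = 0 := by
        have h3 : (2 : ℂ) • word (i :: i :: l.erase i) = 0 := by
          rw [two_smul]; nth_rewrite 1 [h1]; exact neg_add_cancel _
        exact (smul_eq_zero.1 h3).resolve_left two_ne_zero
      rcases word_perm ((List.perm_cons_erase hi).cons i) with h3 | h3 <;> rw [h3, h2]
      exact neg_zero
    · rw [word_cons, ih hl, map_zero]

theorem Hmode_one {n : ℤ} (hn : 0 ≤ n) (s : Bool) : Hmode s n 1 = 0 := by
  rw [Hmode_apply one_mem_vacuumSpace (one_mem_gr chargeWt)]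
  refine finsum_eq_zero_of_forall_eq_zero fun b => ?_
  rcases lt_or_ge b 0 with h | h
  · rw [vp_of_neg _ h, LinearMap.zero_apply]
  · rw [mode, chi_one_of_nonneg (by split_ifs <;> omega), map_zero]

/-- The span of the words. -/
def wordSpan : Submodule ℂ Fock := Submodule.span ℂ (Set.range word)

theorem word_mem_wordSpan (l : List (Bool × ℕ+)) : word l ∈ wordSpan :=
  Submodule.subset_span (Set.mem_range_self l)

theorem Hmode_neg_mem_wordSpan (s : Bool) (m : ℕ+) {v : Fock} (hv : v ∈ wordSpan) :
    Hmode s (-((m : ℕ) : ℤ)) v ∈ wordSpan := by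
  refine Submodule.span_induction (p := fun v _ => Hmode s (-((m : ℕ) : ℤ)) v ∈ wordSpan)
    ?_ ?_ ?_ ?_ hv
  · rintro _ ⟨l, rfl⟩
    have := word_mem_wordSpan ((s, m) :: l)
    rwa [word_cons] at this
  · rw [map_zero]; exact Submodule.zero_mem _
  · intro u w _ _ hu hw
    rw [map_add]; exact Submodule.add_mem _ hu hw
  · intro a u _ hu
    rw [map_smul]; exact Submodule.smul_mem _ _ hu

/-- A nonnegative mode is moved to the right until it kills the vacuum; every central term is a
multiple of a shorter word. -/
theorem Hmode_nonneg_word_mem (s : Bool) {n : ℤ} (hn : 0 ≤ n) (l : List (Bool × ℕ+)) :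
    Hmode s n (word l) ∈ wordSpan := by
  induction l with
  | nil => rw [word_nil, Hmode_one hn]; exact Submodule.zero_mem _
  | cons i l ih =>
    obtain ⟨h1, c, h2⟩ := word_mem l
    rw [word_cons, Hmode_anticomm h1 h2]
    refine Submodule.add_mem _ (Submodule.neg_mem _ (Hmode_neg_mem_wordSpan _ _ ih)) ?_
    split_ifs
    · exact Submodule.smul_mem _ _ (word_mem_wordSpan l)
    · exact Submodule.zero_mem _

theorem Hmode_word_mem (s : Bool) (n : ℤ) (l : List (Bool × ℕ+)) :
    Hmode s n (word l) ∈ wordSpan := by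
  rcases lt_or_ge n 0 with hn | hn
  · obtain ⟨k, rfl⟩ := Int.exists_eq_neg_ofNat hn.le
    exact Hmode_neg_mem_wordSpan s ⟨k, by omega⟩ (word_mem_wordSpan l)
  · exact Hmode_nonneg_word_mem s hn l

/-! ### Linear independence -/

/-- The annihilation operator dual to the creation operator with index `i`. -/
def ann (i : Bool × ℕ+) : Module.End ℂ Fock := Hmode (!i.1) ((i.2 : ℕ) : ℤ)

theorem ann_cons (i j : Bool × ℕ+) (l : List (Bool × ℕ+)) : ann j (word (i :: l)) =
    -Hmode i.1 (-((i.2 : ℕ) : ℤ)) (ann j (word l)) +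
      if i = j then ((sg j.1 : ℂ) * (j.2 : ℕ)) • word l else 0 := by
  obtain ⟨h1, c, h2⟩ := word_mem l
  rw [word_cons, ann, Hmode_anticomm h1 h2, Bool.not_not, sg_not]
  congr 1
  have : (i.1 = j.1 ∧ ((j.2 : ℕ) : ℤ) + -((i.2 : ℕ) : ℤ) = 0) ↔ i = j := by
    rw [Prod.ext_iff, ← PNat.coe_inj]
    exact and_congr_right fun _ => by omega
  simp only [this]
  simp

theorem ann_of_notMem {j : Bool × ℕ+} {l : List (Bool × ℕ+)} (h : j ∉ l) : ann j (word l) = 0 := by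
  induction l with
  | nil => exact Hmode_one (by omega) _
  | cons i l ih =>
    rw [List.mem_cons, not_or] at h
    rw [ann_cons, ih h.2, if_neg (Ne.symm h.1)]
    simp

theorem ann_cons_self {j : Bool × ℕ+} {l : List (Bool × ℕ+)} (h : j ∉ l) :
    ann j (word (j :: l)) = ((sg j.1 : ℂ) * (j.2 : ℕ)) • word l := by
  rw [ann_cons, ann_of_notMem h, if_pos rfl]
  simp

theorem ann_of_mem {j : Bool × ℕ+} {l : List (Bool × ℕ+)} (hl : l.Nodup) (h : j ∈ l) :
    ∃ a : ℂ, ann j (word l) = a • word (l.erase j) := by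
  have h1 : j ∉ l.erase j := hl.not_mem_erase
  rcases word_perm (List.perm_cons_erase h) with h2 | h2
  · exact ⟨_, by rw [h2, ann_cons_self h1]⟩
  · exact ⟨_, by rw [h2, map_neg, ann_cons_self h1, ← neg_smul]⟩

/-- The product of the annihilation operators of a list. -/
def annList : List (Bool × ℕ+) → Module.End ℂ Fock
  | [] => 1
  | j :: l => annList l * ann j

/-- Each annihilator must find its dual letter in the word and removes it, up to a scalar. -/
theorem subset_of_annList_ne_zero {l l' : List (Bool × ℕ+)} (hl : l.Nodup) (hl' : l'.Nodup)
    (h : annList l (word l') ≠ 0) : l ⊆ l' := by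
  induction l generalizing l' with
  | nil => exact List.nil_subset _
  | cons j l ih =>
    rw [annList, Module.End.mul_apply] at h
    by_cases hj : j ∈ l'
    · obtain ⟨a, ha⟩ := ann_of_mem hl' hj
      rw [ha, map_smul] at h
      exact List.cons_subset.2 ⟨hj, List.Subset.trans
        (ih hl.of_cons (hl'.erase j) (right_ne_zero_of_smul h)) List.erase_subset⟩
    · rw [ann_of_notMem hj, map_zero] at h
      exact absurd rfl h

theorem annList_self {l : List (Bool × ℕ+)} (hl : l.Nodup) : annList l (word l) ≠ 0 := by
  induction l with
  | nil => exact one_ne_zero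
  | cons j l ih =>
    rw [annList, Module.End.mul_apply, ann_cons_self (List.nodup_cons.1 hl).1, map_smul]
    refine smul_ne_zero (mul_ne_zero (Int.cast_ne_zero.2 ?_) (Nat.cast_ne_zero.2 j.2.ne_zero))
      (ih hl.of_cons)
    cases j.1 <;> decide

/-- The word of a bipartition. -/
def DistinctBipartition.list (π : DistinctBipartition) : List (Bool × ℕ+) :=
  (π.fst.sort (fun a b => b ≤ a)).map (Prod.mk false) ++
    (π.snd.sort (fun a b => b ≤ a)).map (Prod.mk true)

theorem vector_eq_word (π : DistinctBipartition) : π.vector = word π.list := by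
  simp only [DistinctBipartition.vector, word, DistinctBipartition.list, List.map_append,
    List.map_map, List.prod_append, List.bind_eq_flatMap, List.pure_def, ← List.map_eq_flatMap,
    ← Hmode_false, ← Hmode_true]
  rfl

theorem mem_list (π : DistinctBipartition) (i : Bool × ℕ+) :
    i ∈ π.list ↔ i.2 ∈ if i.1 then π.snd else π.fst := by
  obtain ⟨s, m⟩ := i
  cases s <;> simp [DistinctBipartition.list]

theorem nodup_list (π : DistinctBipartition) : π.list.Nodup := by
  refine List.Nodup.append ?_ ?_ ?_
  · exact (Finset.sort_nodup _ _).map (Prod.mk_right_injective _)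
  · exact (Finset.sort_nodup _ _).map (Prod.mk_right_injective _)
  · intro i hi hi'
    simp only [List.mem_map] at hi hi'
    obtain ⟨_, _, rfl⟩ := hi
    obtain ⟨_, _, h⟩ := hi'
    simp at h

theorem eq_of_list_subset {π ρ : DistinctBipartition} (h : π.list ⊆ ρ.list)
    (hc : ρ.list.length ≤ π.list.length) : π = ρ := by
  have h1 : π.list.Perm ρ.list :=
    (List.subperm_of_subset (nodup_list π) h).perm_of_length_le hc
  have h2 : ∀ i, i ∈ π.list ↔ i ∈ ρ.list := fun i => h1.mem_iff
  simp only [mem_list] at h2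
  obtain ⟨a, b⟩ := π
  obtain ⟨a', b'⟩ := ρ
  congr
  · ext m; simpa using h2 (false, m)
  · ext m; simpa using h2 (true, m)

theorem linearIndependent_vector : LinearIndependent ℂ DistinctBipartition.vector := by
  classical
  rw [linearIndependent_iff']
  intro s g hg
  by_contra! H
  obtain ⟨ρ, hρ, hρ0⟩ := H
  -- In a relation, take a longest word with nonzero coefficient. Its annihilators kill every other
  -- term: a survivor would contain all its letters and be no longer, hence be equal to it.
  obtain ⟨π, hπ, hmax⟩ := (s.filter fun π => g π ≠ 0).exists_max_image
    (fun π => π.list.length) ⟨ρ, Finset.mem_filter.2 ⟨hρ, hρ0⟩⟩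
  rw [Finset.mem_filter] at hπ
  have h1 := congrArg (annList π.list) hg
  rw [map_sum, map_zero, Finset.sum_eq_single π] at h1
  · rw [map_smul, vector_eq_word] at h1
    exact smul_ne_zero hπ.2 (annList_self (nodup_list π)) h1
  · intro τ hτ hne
    by_contra h
    rw [map_smul, vector_eq_word] at h
    have h2 := hmax τ (Finset.mem_filter.2 ⟨hτ, left_ne_zero_of_smul h⟩)
    exact hne (eq_of_list_subset (subset_of_annList_ne_zero (nodup_list π) (nodup_list τ)
      (right_ne_zero_of_smul h)) h2).symm
  · intro h
    exact absurd hπ.1 h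

/-! ### Completeness -/

theorem word_mem_span_vector (l : List (Bool × ℕ+)) :
    word l ∈ Submodule.span ℂ (Set.range DistinctBipartition.vector) := by
  classical
  by_cases hl : l.Nodup
  · let f : Bool → Finset ℕ+ := fun s => (l.filter fun i => i.1 = s).toFinset.image Prod.snd
    let π : DistinctBipartition := ⟨f false, f true⟩
    have h1 : l.Perm π.list := by
      rw [List.perm_ext_iff_of_nodup hl (nodup_list π)]
      rintro ⟨s, m⟩
      rw [mem_list]
      cases s <;> simp [π, f]
    have h2 : π.vector ∈ Submodule.span ℂ (Set.range DistinctBipartition.vector) :=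
      Submodule.subset_span ⟨π, rfl⟩
    rw [vector_eq_word] at h2
    rcases word_perm h1 with h | h <;> rw [h]
    · exact h2
    · exact Submodule.neg_mem _ h2
  · rw [word_eq_zero_of_not_nodup hl]
    exact Submodule.zero_mem _

theorem wordSpan_eq : wordSpan = Submodule.span ℂ (Set.range DistinctBipartition.vector) := by
  refine le_antisymm (Submodule.span_le.2 ?_) (Submodule.span_le.2 ?_)
  · rintro _ ⟨l, rfl⟩
    exact word_mem_span_vector l
  · rintro _ ⟨π, rfl⟩
    exact Submodule.subset_span ⟨π.list, (vector_eq_word π).symm⟩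

/-- The space generated by the words under the creation operators of the Heisenberg algebra. -/
def descendants : Submodule ℂ Fock :=
  Submodule.span ℂ {w | ∃ (ks : List ℕ) (l : List (Bool × ℕ+)),
    w = (ks.map fun k : ℕ => heis (-(k + 1 : ℤ))).prod (word l)}

theorem heis_mem_descendants (i : ℕ) (v : Fock) (hv : v ∈ descendants) :
    heis (-(i + 1 : ℤ)) v ∈ descendants := by
  have : descendants ≤ descendants.comap (heis (-(i + 1 : ℤ))) := by
    refine Submodule.span_le.2 ?_
    rintro _ ⟨ks, l, rfl⟩
    exact Submodule.subset_span ⟨i :: ks, l, by simp⟩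
  exact this hv

theorem word_mem_descendants (l : List (Bool × ℕ+)) : word l ∈ descendants :=
  Submodule.subset_span ⟨[], l, by simp⟩

theorem wordSpan_le_descendants : wordSpan ≤ descendants := by
  refine Submodule.span_le.2 ?_
  rintro _ ⟨l, rfl⟩
  exact word_mem_descendants l

/-- Since `V⁺` starts with `1`, a mode of `H` equals the corresponding bare mode plus descendants of
bare modes of higher index. High bare modes vanish, so one descends on the index. -/
theorem mode_word_mem (s : Bool) (l : List (Bool × ℕ+)) (n : ℤ) :
    mode s n (word l) ∈ descendants := by
  obtain ⟨D, hD⟩ := exists_mode_eq_zero (word l)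
  have key : ∀ (k : ℕ) (n : ℤ), D - n ≤ k → mode s n (word l) ∈ descendants := by
    intro k
    induction k with
    | zero =>
      intro n hn
      rw [hD s n (by push_cast at hn; omega)]
      exact Submodule.zero_mem _
    | succ k ih =>
      intro n hn
      obtain ⟨h1, c, h2⟩ := word_mem l
      have h3 := Hmode_apply h1 h2 s (n - sg s * c)
      rw [sub_add_cancel] at h3
      have h4 : ∀ b : ℤ, vp (sg s) b (mode s (n + b) (word l)) =
          (if b = 0 then mode s n (word l) else 0) +
            if b = 0 then 0 else vp (sg s) b (mode s (n + b) (word l)) := by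
        intro b
        split_ifs with hb
        · rw [hb, vp_zero]; simp
        · rw [zero_add]
      rw [finsum_congr h4, finsum_add_distrib,
        finsum_eq_single (fun b : ℤ => if b = 0 then mode s n (word l) else 0) 0
          (fun b hb => if_neg hb), if_pos rfl] at h3
      · rw [← sub_eq_iff_eq_add] at h3
        rw [← h3]
        refine Submodule.sub_mem _ (wordSpan_le_descendants (Hmode_word_mem _ _ _))
          (finsum_mem_submodule _ fun b => ?_)
        split_ifs with hb
        · exact Submodule.zero_mem _
        · rcases lt_or_ge b 0 with h | h
          · rw [vp_of_neg _ h]; exact Submodule.zero_mem _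
          · exact vp_mem_of_stable heis_mem_descendants (ih _ (by push_cast at hn; omega)) _ _
      · exact (Set.finite_singleton 0).subset fun b hb => by by_contra h; exact hb (if_neg h)
      · refine (vp_mode_finite (sg s) s n (word l)).subset fun b hb h => hb ?_
        simp only at h ⊢
        rw [h, ite_self]
  exact key (D - n).toNat n (Int.self_le_toNat _)

theorem mode_mem_descendants (s : Bool) (n : ℤ) (v : Fock) (hv : v ∈ descendants) :
    mode s n v ∈ descendants := by
  have : descendants ≤ descendants.comap (mode s n) := by
    refine Submodule.span_le.2 ?_
    rintro _ ⟨ks, l, rfl⟩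
    change mode s n _ ∈ descendants
    induction ks generalizing n with
    | nil => exact mode_word_mem s l n
    | cons k ks ih =>
      rw [List.map_cons, List.prod_cons, Module.End.mul_apply, mode_heis]
      exact Submodule.sub_mem _ (heis_mem_descendants _ _ (ih n)) (Submodule.smul_mem _ _ (ih _))
  exact this hv

theorem descendants_eq_top : descendants = ⊤ := by
  refine eq_top_of_chi_stable _ (word_mem_descendants []) fun j v hv => ?_
  rcases Int.even_or_odd' (Int.negSucc j) with ⟨n, hn | hn⟩ <;> rw [hn]
  · have := mode_mem_descendants false n v hv
    simpa [mode] using this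
  · have := mode_mem_descendants true n v hv
    simpa [mode] using this

/-- All vectors are descendants, so Fock space is `wordSpan ⊔ hNeg`. The `hNeg` part of a vacuum
vector is itself a vacuum vector and thus zero. -/
theorem vacuumSpace_eq : vacuumSpace = Submodule.span ℂ (Set.range DistinctBipartition.vector) := by
  rw [← wordSpan_eq]
  have hle : wordSpan ≤ vacuumSpace := by
    refine Submodule.span_le.2 ?_
    rintro _ ⟨l, rfl⟩
    exact (word_mem l).1
  refine le_antisymm (fun v hv => ?_) hle
  have h1 : descendants ≤ wordSpan ⊔ hNeg := by
    refine Submodule.span_le.2 ?_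
    rintro _ ⟨ks, l, rfl⟩
    rcases ks with _ | ⟨k, ks⟩
    · exact Submodule.mem_sup_left (Submodule.subset_span ⟨l, rfl⟩)
    · rw [List.map_cons, List.prod_cons, Module.End.mul_apply]
      exact Submodule.mem_sup_right (heis_mem_hNeg _ _)
  rw [descendants_eq_top] at h1
  obtain ⟨u, hu, w, hw, rfl⟩ := Submodule.mem_sup.1 (h1 (Submodule.mem_top (x := v)))
  have h2 : w ∈ vacuumSpace := by
    have := vacuumSpace.sub_mem hv (hle hu)
    rwa [add_sub_cancel_left] at this
  rwa [eq_zero_of_mem_hNeg h2 hw, add_zero]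

/-! ### Charges and degrees -/

/-- The charge drops by one with each mode and enters the next degree shift through `w^{-h_0}`.
Summing these shifts gives the quadratic term and, with initial charge `c = s`, the cross term of
`twoW`. -/
theorem word_append_false {c d : ℤ} {l : List (Bool × ℕ+)} (hc : word l ∈ gr chargeWt c)
    (hd : word l ∈ gr degWt d) (l' : List ℕ+) :
    word (l'.map (Prod.mk false) ++ l) ∈ gr chargeWt (c - l'.length) ∧
    word (l'.map (Prod.mk false) ++ l) ∈ gr degWt (d + 4 * (l'.map fun m : ℕ+ => ((m : ℕ) : ℤ)).sum +
      4 * l'.length * c - 2 * l'.length ^ 2 + l'.length) := by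
  induction l' with
  | nil => simpa using ⟨hc, hd⟩
  | cons m l' ih =>
    have h1 := (word_mem (l'.map (Prod.mk false) ++ l)).1
    rw [List.map_cons, List.cons_append, word_cons]
    constructor
    · have := Hmode_mem_charge h1 ih.1 false (-((m : ℕ) : ℤ))
      convert this using 2
      simp [sg]
      ring
    · have := Hmode_mem_deg h1 ih.1 ih.2 false (-((m : ℕ) : ℤ))
      convert this using 2
      simp [sg]
      ring

theorem word_true (l : List ℕ+) :
    word (l.map (Prod.mk true)) ∈ gr chargeWt l.length ∧
    word (l.map (Prod.mk true)) ∈ gr degWt (4 * (l.map fun m : ℕ+ => ((m : ℕ) : ℤ)).sum -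
      2 * l.length ^ 2 - l.length) := by
  induction l with
  | nil => simpa [word_nil] using ⟨one_mem_gr chargeWt, one_mem_gr degWt⟩
  | cons m l ih =>
    have h1 := (word_mem (l.map (Prod.mk true))).1
    rw [List.map_cons, word_cons]
    constructor
    · have := Hmode_mem_charge h1 ih.1 true (-((m : ℕ) : ℤ))
      convert this using 2
      simp [sg]
    · have := Hmode_mem_deg h1 ih.1 ih.2 true (-((m : ℕ) : ℤ))
      convert this using 2
      simp [sg]
      ring

/-- Twice `W`, an integer. -/
def DistinctBipartition.twoW (π : DistinctBipartition) : ℤ :=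
  4 * (∑ m ∈ π.fst, ((m : ℕ) : ℤ) + ∑ m ∈ π.snd, ((m : ℕ) : ℤ)) + 4 * π.fst.card * π.snd.card
    - 2 * π.fst.card ^ 2 + π.fst.card - 2 * π.snd.card ^ 2 - π.snd.card

theorem twoW_cast (π : DistinctBipartition) : (π.twoW : ℚ) = 2 * π.W := by
  simp only [DistinctBipartition.twoW, DistinctBipartition.W, DistinctBipartition.weight, partSum]
  push_cast
  ring

theorem sum_map_sort (s : Finset ℕ+) (f : ℕ+ → ℤ) :
    ((s.sort (fun a b => b ≤ a)).map f).sum = ∑ m ∈ s, f m := by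
  rw [← List.sum_toFinset _ (Finset.sort_nodup _ _), Finset.sort_toFinset]

theorem vector_mem_charge (π : DistinctBipartition) : π.vector ∈ gr chargeWt π.birank := by
  have h1 := word_true (π.snd.sort (fun a b => b ≤ a))
  have h2 := (word_append_false h1.1 h1.2 (π.fst.sort (fun a b => b ≤ a))).1
  rw [Finset.length_sort, Finset.length_sort] at h2
  rw [vector_eq_word]
  exact h2

theorem vector_mem_deg (π : DistinctBipartition) : π.vector ∈ gr degWt π.twoW := by
  have h1 := word_true (π.snd.sort (fun a b => b ≤ a))
  have h2 := (word_append_false h1.1 h1.2 (π.fst.sort (fun a b => b ≤ a))).2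
  rw [Finset.length_sort, Finset.length_sort, sum_map_sort, sum_map_sort] at h2
  rw [vector_eq_word]
  refine Eq.subst (motive := fun d => word π.list ∈ gr degWt d) ?_ h2
  rw [DistinctBipartition.twoW]
  ring

theorem vector_ne_zero (π : DistinctBipartition) : π.vector ≠ 0 :=
  linearIndependent_vector.ne_zero π

/-- A combinatorial inequality obtained from the Fock space: the vector is nonzero, and degrees
there are nonnegative. -/
theorem twoW_nonneg (π : DistinctBipartition) : 0 ≤ π.twoW := by
  by_contra h
  exact vector_ne_zero π (gr_deg_neg (not_le.1 h) (vector_mem_deg π))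

theorem hasCharge_vector (π : DistinctBipartition) : HasCharge π.vector (π.birank : ℂ) :=
  ⟨vector_ne_zero π, heis_zero_apply (vector_mem_charge π)⟩

theorem hasDegree_vector (π : DistinctBipartition) : HasDegree π.vector (π.W : ℂ) := by
  refine ⟨vector_ne_zero π, ?_⟩
  rw [L0_apply (vector_mem_deg π)]
  congr 1
  have : ((π.twoW : ℚ) : ℂ) = ((2 * π.W : ℚ) : ℂ) := by rw [twoW_cast]
  push_cast at this
  rw [this]
  ring

theorem vector_mem_vacuumSpace (π : DistinctBipartition) : π.vector ∈ vacuumSpace := by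
  rw [vector_eq_word]
  exact (word_mem _).1

theorem isHighestWeight_vector (π : DistinctBipartition) : IsHighestWeight π.vector :=
  ⟨mem_vacuumSpace.1 (vector_mem_vacuumSpace π), _, hasCharge_vector π⟩

theorem highestWeightSpace_eq :
    highestWeightSpace = Submodule.span ℂ (Set.range DistinctBipartition.vector) := by
  refine le_antisymm (Submodule.span_le.2 fun v hv => ?_) (Submodule.span_mono ?_)
  · rw [← vacuumSpace_eq]
    exact mem_vacuumSpace.2 hv.1
  · rintro _ ⟨π, rfl⟩
    exact isHighestWeight_vector π

/-! ### Graded dimensions -/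

theorem finite_weight_degWt (d : ℤ) : {s : ℕ →₀ ℕ | Finsupp.weight degWt s = d}.Finite := by
  refine ((Finset.range (d.toNat + 1)).finsupp
    fun _ => Finset.range (d.toNat + 1)).finite_toSet.subset fun s hs => ?_
  have key : ∀ i, s i ≠ 0 → (s i : ℤ) * (2 * i + 1) ≤ d := by
    intro i hi
    rw [← show Finsupp.weight degWt s = d from hs, Finsupp.weight_apply, Finsupp.sum]
    have := Finset.single_le_sum (f := fun i => s i • degWt i) (s := s.support)
      (fun j _ => nsmul_nonneg (by unfold degWt; omega) _) (Finsupp.mem_support_iff.2 hi)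
    simpa [degWt] using this
  rw [Finset.mem_coe, Finset.mem_finsupp_iff]
  have key2 : ∀ i, s i ≠ 0 → i < d.toNat + 1 ∧ s i < d.toNat + 1 := by
    intro i hi
    have h1 := key i hi
    have h2 : (1 : ℤ) ≤ s i := by exact_mod_cast Nat.one_le_iff_ne_zero.2 hi
    have h3 : (2 * i + 1 : ℤ) ≤ s i * (2 * i + 1) := le_mul_of_one_le_left (by omega) h2
    have h4 : (s i : ℤ) ≤ s i * (2 * i + 1) := le_mul_of_one_le_right (by omega) (by omega)
    omega
  refine ⟨fun i hi => ?_, fun i _ => ?_⟩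
  · exact Finset.mem_range.2 (key2 i (Finsupp.mem_support_iff.1 hi)).1
  · rw [Finset.mem_range]
    by_cases hi : s i = 0
    · omega
    · exact (key2 i hi).2

instance finite_gr_deg (d : ℤ) : Module.Finite ℂ (gr degWt d) := by
  rw [gr, MvPolynomial.weightedHomogeneousSubmodule_eq_finsupp_supported]
  have := (finite_weight_degWt d).to_subtype
  exact Module.Finite.of_basis (MvPolynomial.basisRestrictSupport ℂ {s | Finsupp.weight degWt s = d})

/-- The graded dimension of a subspace, as a power series in `t`, where `t²` marks the degree. -/
def gradedDim (K : Submodule ℂ Fock) : PowerSeries ℤ :=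
  PowerSeries.mk fun d => (Module.finrank ℂ (gr degWt d ⊓ K : Submodule ℂ Fock) : ℤ)

section Oscillator

variable {x y : Module.End ℂ Fock} {a : ℂ} {k : ℕ} {K : Submodule ℂ Fock}

theorem oscillator_comm_pow (hxy : ∀ v, y (x v) = x (y v) + a • v) (M : ℕ) (v : Fock) :
    y ((x ^ (M + 1)) v) = (x ^ (M + 1)) (y v) + ((M + 1 : ℂ) * a) • (x ^ M) v := by
  induction M with
  | zero => simp [hxy]
  | succ M ih =>
    rw [pow_succ' x (M + 1), Module.End.mul_apply, Module.End.mul_apply, hxy, ih, map_add, map_smul,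
      show x ((x ^ M) v) = (x ^ (M + 1)) v by rw [pow_succ', Module.End.mul_apply], add_assoc,
      ← add_smul]
    congr 2
    push_cast
    ring

/-- Surjectivity of the lowering operator makes rank-nullity yield an exact dimension count. -/
theorem oscillator_surjective (ha : a ≠ 0) (hk : 0 < k) (hxy : ∀ v, y (x v) = x (y v) + a • v)
    (hx : ∀ d, ∀ v ∈ gr degWt d, x v ∈ gr degWt (d + k))
    (hy : ∀ d, ∀ v ∈ gr degWt d, y v ∈ gr degWt (d - k))
    (hxK : ∀ v ∈ K, x v ∈ K) (hyK : ∀ v ∈ K, y v ∈ K) {d : ℤ} {v : Fock}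
    (hv : v ∈ gr degWt (d - k)) (hvK : v ∈ K) : ∃ u ∈ gr degWt d, u ∈ K ∧ y u = v := by
  have hyM : ∀ M : ℕ, (y ^ M) v ∈ gr degWt (d - k - M * k) ∧ (y ^ M) v ∈ K := by
    intro M
    induction M with
    | zero => simpa using ⟨hv, hvK⟩
    | succ M ih =>
      rw [pow_succ', Module.End.mul_apply]
      refine ⟨?_, hyK _ ih.2⟩
      have := hy _ _ ih.1
      rwa [show d - k - M * k - (k : ℤ) = d - k - (M + 1 : ℕ) * k by push_cast; ring] at this
  have hxM : ∀ M : ℕ, ∀ e, ∀ w ∈ gr degWt e, w ∈ K →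
      (x ^ M) w ∈ gr degWt (e + M * k) ∧ (x ^ M) w ∈ K := by
    intro M e w hw hwK
    induction M with
    | zero => simpa using ⟨hw, hwK⟩
    | succ M ih =>
      rw [pow_succ', Module.End.mul_apply]
      refine ⟨?_, hxK _ ih.2⟩
      have := hx _ _ ih.1
      rwa [show e + M * k + (k : ℤ) = e + (M + 1 : ℕ) * k by push_cast; ring] at this
  -- An approximate preimage with error proportional to `x^M y^M v` is corrected by a multiple of
  -- `x^{M+1} y^M v`, which pushes the error to `M + 1`. For large `M` the vector `y^M v` has
  -- negative degree and vanishes.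
  have key : ∀ M : ℕ, ∃ u ∈ gr degWt d, u ∈ K ∧ ∃ b : ℂ, y u = v - b • (x ^ M) ((y ^ M) v) := by
    intro M
    induction M with
    | zero => exact ⟨0, Submodule.zero_mem _, Submodule.zero_mem _, 1, by simp⟩
    | succ M ih =>
      obtain ⟨u, hu, huK, b, hb⟩ := ih
      have h1 := hxM (M + 1) _ _ (hyM M).1 (hyM M).2
      rw [show d - k - M * k + (M + 1 : ℕ) * (k : ℤ) = d by push_cast; ring] at h1
      refine ⟨u + (b / ((M + 1) * a)) • (x ^ (M + 1)) ((y ^ M) v),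
        Submodule.add_mem _ hu (Submodule.smul_mem _ _ h1.1),
        Submodule.add_mem _ huK (Submodule.smul_mem _ _ h1.2), -(b / ((M + 1) * a)), ?_⟩
      rw [map_add, map_smul, oscillator_comm_pow hxy, hb, smul_add, smul_smul,
        div_mul_cancel₀ _ (mul_ne_zero (Nat.cast_add_one_ne_zero M) ha), pow_succ' y M,
        Module.End.mul_apply, neg_smul]
      abel
  obtain ⟨u, hu, huK, b, hb⟩ := key (d.toNat + 1)
  refine ⟨u, hu, huK, ?_⟩
  rw [hb, gr_deg_neg _ (hyM (d.toNat + 1)).1]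
  · simp
  · have h1 : (d.toNat + 1 : ℤ) ≤ (d.toNat + 1) * k := le_mul_of_one_le_right (by omega) (by omega)
    push_cast
    omega

/-- Passing to the kernel of an oscillator of degree `k/2` multiplies the graded dimension
by `1 - t^k`. -/
theorem gradedDim_inf_ker (ha : a ≠ 0) (hk : 0 < k) (hxy : ∀ v, y (x v) = x (y v) + a • v)
    (hx : ∀ d, ∀ v ∈ gr degWt d, x v ∈ gr degWt (d + k))
    (hy : ∀ d, ∀ v ∈ gr degWt d, y v ∈ gr degWt (d - k))
    (hxK : ∀ v ∈ K, x v ∈ K) (hyK : ∀ v ∈ K, y v ∈ K) :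
    gradedDim (K ⊓ LinearMap.ker y) = (1 - PowerSeries.X ^ k) * gradedDim K := by
  have hfin : ∀ d : ℤ, ∀ L : Submodule ℂ Fock,
      Module.Finite ℂ (gr degWt d ⊓ L : Submodule ℂ Fock) := fun d L =>
    Module.Finite.of_injective (Submodule.inclusion inf_le_left)
      (Submodule.inclusion_injective _)
  -- Rank-nullity for `y` from weight `d` onto weight `d - k`.
  have key : ∀ d : ℤ, Module.finrank ℂ (gr degWt d ⊓ K : Submodule ℂ Fock) =
      Module.finrank ℂ (gr degWt (d - k) ⊓ K : Submodule ℂ Fock) +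
      Module.finrank ℂ (gr degWt d ⊓ (K ⊓ LinearMap.ker y) : Submodule ℂ Fock) := by
    intro d
    let f : (gr degWt d ⊓ K : Submodule ℂ Fock) →ₗ[ℂ] (gr degWt (d - k) ⊓ K : Submodule ℂ Fock) :=
      y.restrict fun v hv => ⟨hy d v hv.1, hyK v hv.2⟩
    have := hfin d K
    rw [← f.finrank_range_add_finrank_ker]
    congr 1
    · rw [LinearMap.range_eq_top.2, finrank_top]
      rintro ⟨v, hv, hvK⟩
      obtain ⟨u, hu, huK, h⟩ := oscillator_surjective ha hk hxy hx hy hxK hyK hv hvK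
      exact ⟨⟨u, hu, huK⟩, Subtype.ext h⟩
    · have hker : (LinearMap.ker f).map (gr degWt d ⊓ K).subtype =
          gr degWt d ⊓ (K ⊓ LinearMap.ker y) := by
        ext v
        simp only [Submodule.mem_map, LinearMap.mem_ker, Submodule.mem_inf]
        constructor
        · rintro ⟨u, hu, rfl⟩
          exact ⟨u.2.1, u.2.2, congrArg Subtype.val hu⟩
        · rintro ⟨h1, h2, h3⟩
          exact ⟨⟨v, h1, h2⟩, Subtype.ext h3, rfl⟩
      rw [← hker, Submodule.finrank_map_subtype_eq]
  ext d
  rw [sub_mul, one_mul, map_sub, PowerSeries.coeff_X_pow_mul', gradedDim, gradedDim,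
    PowerSeries.coeff_mk, PowerSeries.coeff_mk, key d]
  split_ifs with h
  · rw [PowerSeries.coeff_mk, Nat.cast_sub h]
    push_cast
    ring
  · have : (gr degWt ((d : ℤ) - k) ⊓ K : Submodule ℂ Fock) = ⊥ := by
      refine (Submodule.eq_bot_iff _).2 fun v hv => gr_deg_neg (by omega) hv.1
    rw [this]
    simp

end Oscillator

section Oscillators

variable {x y : ℕ → Module.End ℂ Fock} {a : ℕ → ℂ} {k : ℕ → ℕ}

/-- An oscillator preserves the kernels of the earlier lowering operators, so each new kernel
contributes one factor. -/
theorem gradedDim_iInf_ker (ha : ∀ i, a i ≠ 0) (hk : ∀ i, 0 < k i)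
    (hxy : ∀ i v, y i (x i v) = x i (y i v) + a i • v)
    (hxy' : ∀ i j, i ≠ j → ∀ v, y i (x j v) = x j (y i v))
    (hyy : ∀ i j v, y i (y j v) = y j (y i v))
    (hx : ∀ i d, ∀ v ∈ gr degWt d, x i v ∈ gr degWt (d + k i))
    (hy : ∀ i d, ∀ v ∈ gr degWt d, y i v ∈ gr degWt (d - k i)) (N : ℕ) :
    gradedDim (⨅ i ∈ Finset.range N, LinearMap.ker (y i)) =
      (∏ i ∈ Finset.range N, (1 - PowerSeries.X ^ k i)) * gradedDim ⊤ := by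
  induction N with
  | zero => simp
  | succ N ih =>
    have h1 : (⨅ i ∈ Finset.range (N + 1), LinearMap.ker (y i)) =
        (⨅ i ∈ Finset.range N, LinearMap.ker (y i)) ⊓ LinearMap.ker (y N) := by
      rw [Finset.range_add_one, Finset.iInf_insert, inf_comm]
    rw [h1, gradedDim_inf_ker (ha N) (hk N) (hxy N) (hx N) (hy N), ih, Finset.prod_range_succ]
    · ring
    · intro v hv
      simp only [Submodule.mem_iInf, LinearMap.mem_ker, Finset.mem_range] at hv ⊢
      intro i hi
      rw [hxy' i N hi.ne, hv i hi, map_zero]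
    · intro v hv
      simp only [Submodule.mem_iInf, LinearMap.mem_ker, Finset.mem_range] at hv ⊢
      intro i hi
      rw [hyy, hv i hi, map_zero]

/-- Oscillators of index at least `N` lower the degree below zero; in weight `d` finitely many
kernels suffice. -/
theorem gr_inf_iInf_ker (hk : ∀ i, i < k i)
    (hy : ∀ i d, ∀ v ∈ gr degWt d, y i v ∈ gr degWt (d - k i)) {d N : ℕ} (h : d ≤ N) :
    gr degWt d ⊓ (⨅ i ∈ Finset.range N, LinearMap.ker (y i)) =
      gr degWt d ⊓ ⨅ i, LinearMap.ker (y i) := by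
  ext v
  simp only [Submodule.mem_inf, Submodule.mem_iInf, LinearMap.mem_ker, Finset.mem_range]
  refine and_congr_right fun hv => ⟨fun H i => ?_, fun H i _ => H i⟩
  rcases lt_or_ge i N with hi | hi
  · exact H i hi
  · refine gr_deg_neg ?_ (hy i d v hv)
    have := hk i
    omega

end Oscillators

/-- The graded dimension of the Fock space. -/
theorem coeff_gradedDim_top {d N : ℕ} (h : d ≤ N) : PowerSeries.coeff d
    ((∏ j ∈ Finset.range N, (1 - PowerSeries.X ^ (2 * j + 1) : PowerSeries ℤ)) * gradedDim ⊤) =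
      if d = 0 then 1 else 0 := by
  have hy : ∀ (i : ℕ) d, ∀ v ∈ gr degWt d, chi (Int.ofNat i) v ∈ gr degWt (d - (2 * i + 1 : ℕ)) :=
    fun i d v hv => chi_mem_deg hv (Int.ofNat i)
  -- The `χ` form oscillators of weights `2j + 1`, whose joint kernel is the line of the vacuum.
  rw [← gradedDim_iInf_ker (x := fun j => chi (Int.negSucc j)) (y := fun j => chi (Int.ofNat j))
    (a := fun j => (-1) ^ j) (k := fun j => 2 * j + 1) (fun i => pow_ne_zero _ (by norm_num))
    (fun i => Nat.succ_pos _) ?_ ?_ ?_ ?_ hy, gradedDim, PowerSeries.coeff_mk,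
    gr_inf_iInf_ker (y := fun j => chi (Int.ofNat j)) (k := fun j => 2 * j + 1)
      (fun i => by omega) hy h]
  · have key : ∀ v : Fock, v ∈ (⨅ i : ℕ, LinearMap.ker (chi (Int.ofNat i))) → ∃ c : ℂ, v = c • 1 :=
      fun v hv => eq_smul_one_of_chi_eq_zero fun j => by
        simpa using (Submodule.mem_iInf _).1 hv j
    split_ifs with hd
    · subst hd
      have : (gr degWt (0 : ℕ) ⊓ ⨅ i : ℕ, LinearMap.ker (chi (Int.ofNat i)) : Submodule ℂ Fock) =
          ℂ ∙ (1 : Fock) := by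
        refine le_antisymm (fun v hv => ?_) ?_
        · obtain ⟨c, hc⟩ := key v hv.2
          exact Submodule.mem_span_singleton.2 ⟨c, hc.symm⟩
        · rw [Submodule.span_singleton_le_iff_mem]
          exact ⟨one_mem_gr _, (Submodule.mem_iInf _).2 fun j => chi_vacuum j⟩
      rw [this, finrank_span_singleton one_ne_zero]
      rfl
    · have : (gr degWt (d : ℤ) ⊓ ⨅ i : ℕ, LinearMap.ker (chi (Int.ofNat i)) : Submodule ℂ Fock) =
          ⊥ := by
        refine (Submodule.eq_bot_iff _).2 fun v hv => ?_
        obtain ⟨c, hc⟩ := key v hv.2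
        exact gr_disjoint hv.1 (hc ▸ Submodule.smul_mem _ c (one_mem_gr degWt)) (by omega)
      rw [this]
      simp
  · intro i v
    have := chi_chi_sub (Int.ofNat i) (Int.negSucc i) v
    rw [if_pos (by rw [Int.negSucc_eq]; simp), sub_eq_iff_eq_add'] at this
    simpa using this
  · intro i j hij v
    refine chi_chi_comm ?_ v
    rw [Int.negSucc_eq]
    simp only [Int.ofNat_eq_natCast]
    omega
  · intro i j v
    refine chi_chi_comm ?_ v
    simp only [Int.ofNat_eq_natCast]
    omega
  · intro i d v hv
    have := chi_mem_deg hv (Int.negSucc i)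
    rwa [show d - (2 * Int.negSucc i + 1) = d + (2 * i + 1 : ℕ) by
      rw [Int.negSucc_eq]; push_cast; ring] at this

/-- The graded dimension of the vacuum space of the Heisenberg algebra. -/
theorem coeff_gradedDim_vacuumSpace {d N : ℕ} (h : d ≤ N) : PowerSeries.coeff d
    ((∏ j ∈ Finset.range N, (1 - PowerSeries.X ^ (4 * (j + 1)) : PowerSeries ℤ)) * gradedDim ⊤) =
      Module.finrank ℂ (gr degWt d ⊓ vacuumSpace : Submodule ℂ Fock) := by
  have hy : ∀ (i : ℕ) d, ∀ v ∈ gr degWt d, heis (i + 1) v ∈ gr degWt (d - (4 * (i + 1) : ℕ)) :=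
    fun i d v hv => heis_mem_deg hv (i + 1)
  rw [← gradedDim_iInf_ker (x := fun j : ℕ => heis (-(j + 1 : ℤ))) (y := fun j : ℕ => heis (j + 1))
    (a := fun j => -((j + 1 : ℤ) : ℂ)) (k := fun j => 4 * (j + 1)) ?_
    (fun i => by omega) ?_ ?_ ?_ ?_ hy, gradedDim, PowerSeries.coeff_mk,
    gr_inf_iInf_ker (y := fun j : ℕ => heis (j + 1)) (k := fun j => 4 * (j + 1))
      (fun i => by omega) hy h, vacuumSpace]
  · intro i
    exact neg_ne_zero.2 (Int.cast_ne_zero.2 (by omega))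
  · intro i v
    rw [heis_comm, if_pos (by ring), neg_smul, sub_eq_add_neg]
  · intro i j hij v
    rw [heis_comm, if_neg (by omega), sub_zero]
  · intro i j v
    rw [heis_comm, if_neg (by omega), sub_zero]
  · intro i d v hv
    have := heis_mem_deg hv (-(i + 1))
    rwa [show d - 4 * -((i : ℤ) + 1) = d + (4 * (i + 1) : ℕ) by push_cast; ring] at this

/-! ### Counting bipartitions -/

theorem gr_inf_vacuumSpace (d : ℤ) : (gr degWt d ⊓ vacuumSpace : Submodule ℂ Fock) =
    Submodule.span ℂ (Set.range fun π : {π : DistinctBipartition // π.twoW = d} => π.1.vector) := by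
  refine le_antisymm (fun v hv => ?_) (Submodule.span_le.2 ?_)
  · obtain ⟨h1, h2⟩ := hv
    rw [SetLike.mem_coe, vacuumSpace_eq, Finsupp.mem_span_range_iff_exists_finsupp] at h2
    obtain ⟨g, hg⟩ := h2
    have h3 := MvPolynomial.IsWeightedHomogeneous.weightedHomogeneousComponent_same h1
    rw [← h3, ← hg, Finsupp.sum, map_sum]
    refine Submodule.sum_mem _ fun π _ => ?_
    rw [map_smul]
    refine Submodule.smul_mem _ _ ?_
    by_cases h : π.twoW = d
    · rw [← h, MvPolynomial.IsWeightedHomogeneous.weightedHomogeneousComponent_same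
        (vector_mem_deg π)]
      exact Submodule.subset_span ⟨⟨π, rfl⟩, rfl⟩
    · rw [MvPolynomial.IsWeightedHomogeneous.weightedHomogeneousComponent_ne _
        (vector_mem_deg π) (Ne.symm h)]
      exact Submodule.zero_mem _
  · rintro _ ⟨⟨π, rfl⟩, rfl⟩
    exact ⟨vector_mem_deg π, vector_mem_vacuumSpace π⟩

/-- The homogeneous basis vectors of weight `d` turn a dimension into a count; finiteness of the
fibre is inherited from the graded piece. -/
theorem card_bipartition (d : ℤ) : Finite {π : DistinctBipartition // π.twoW = d} ∧
    Module.finrank ℂ (gr degWt d ⊓ vacuumSpace : Submodule ℂ Fock) =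
      Nat.card {π : DistinctBipartition // π.twoW = d} := by
  have hli : LinearIndependent ℂ
      (fun π : {π : DistinctBipartition // π.twoW = d} => π.1.vector) :=
    linearIndependent_vector.comp _ Subtype.val_injective
  have hfin : Module.Finite ℂ (gr degWt d ⊓ vacuumSpace : Submodule ℂ Fock) :=
    Module.Finite.of_injective (Submodule.inclusion inf_le_left)
      (Submodule.inclusion_injective _)
  rw [gr_inf_vacuumSpace] at hfin ⊢
  exact ⟨Module.Finite.finite_basis (Module.Basis.span hli),
    Module.finrank_eq_nat_card_basis (Module.Basis.span hli)⟩

/-! ### Gauss' identity for triangular numbers -/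

section Gauss

variable {R : Type*} [CommRing R] (x : R)

/-- The product `∏_{s < j ≤ n} (1 - q^{2j})`, `q = x²`. -/
def evenProd (n s : ℕ) : R := ∏ j ∈ Finset.Ico s n, (1 - x ^ (4 * (j + 1)))

/-- The product `∏_{j ≤ n} (1 - q^{2j-1})`, `q = x²`. -/
def oddProd (n : ℕ) : R := ∏ j ∈ Finset.range n, (1 - x ^ (4 * j + 2))

theorem oddProd_succ (n : ℕ) : oddProd x (n + 1) = oddProd x n * (1 - x ^ (4 * n + 2)) :=
  Finset.prod_range_succ _ _

theorem evenProd_succ {n s : ℕ} (h : s ≤ n) :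
    evenProd x (n + 1) s = evenProd x n s * (1 - x ^ (4 * (n + 1))) :=
  Finset.prod_Ico_succ_top h _

theorem evenProd_eq {n s : ℕ} (h : s < n) :
    evenProd x n s = (1 - x ^ (4 * (s + 1))) * evenProd x n (s + 1) :=
  Finset.prod_eq_prod_Ico_succ_bot h _

theorem evenProd_self (n : ℕ) : evenProd x n n = 1 := by simp [evenProd]

/-- The left hand side of Shanks' finite form of Gauss' identity. -/
def shanksSum (n : ℕ) : R :=
  ∑ s ∈ Finset.range (n + 1), evenProd x n s * oddProd x s * x ^ (2 * s * (2 * n + 1))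

/-- The recursion from `n` to `n + 1` holds already for partial sums, with an explicit boundary
term; this permits induction on the upper limit. -/
theorem shanks_telescope (n t : ℕ) (h : t ≤ n) :
    ∑ s ∈ Finset.range (t + 1), (evenProd x (n + 1) s * oddProd x s * x ^ (2 * s * (2 * n + 3)) -
      (1 - x ^ (4 * n + 2)) * (evenProd x n s * oddProd x s * x ^ (2 * s * (2 * n + 1)))) =
    evenProd x n t * oddProd x (t + 1) * x ^ (2 * (t + 1) * (2 * n + 1)) := by
  induction t with
  | zero =>
    rw [zero_add, Finset.sum_range_one, evenProd_succ x h, oddProd_succ]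
    simp only [oddProd, Finset.range_zero, Finset.prod_empty]
    ring
  | succ t ih =>
    rw [Finset.sum_range_succ, ih (by omega), evenProd_succ x h, evenProd_eq x (show t < n by omega),
      oddProd_succ x (t + 1)]
    ring

/-- Shanks' finite form of Gauss' identity. -/
theorem shanksSum_eq (n : ℕ) :
    shanksSum x n = oddProd x n * ∑ m ∈ Finset.range (2 * n + 1), x ^ (m * (m + 1)) := by
  induction n with
  | zero => simp [shanksSum, evenProd, oddProd]
  | succ n ih =>
    have h1 := shanks_telescope x n n le_rfl
    rw [Finset.sum_sub_distrib, ← Finset.mul_sum, evenProd_self, one_mul, sub_eq_iff_eq_add,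
      ← shanksSum, ih] at h1
    rw [shanksSum, Finset.sum_range_succ, evenProd_self, one_mul]
    -- The new triangular exponents come from the boundary term (`m = 2n + 1`) and from the last
    -- summand `s = n + 1` (`m = 2n + 2`).
    rw [show 2 * (n + 1) + 1 = 2 * n + 3 by ring, h1, Finset.sum_range_succ _ (2 * n + 2),
      Finset.sum_range_succ _ (2 * n + 1), oddProd_succ]
    ring

/-- Gauss' identity `∏ (1 - q^{2j}) = ∏ (1 - q^{2j-1}) ∑ q^{m(m+1)/2}`, truncated. -/
theorem gauss_dvd (n : ℕ) : x ^ (4 * n + 2) ∣ ∏ j ∈ Finset.range n, (1 - x ^ (4 * (j + 1))) -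
    oddProd x n * ∑ m ∈ Finset.range (2 * n + 1), x ^ (m * (m + 1)) := by
  rw [← shanksSum_eq, shanksSum, Finset.sum_range_succ', ← dvd_neg, neg_sub]
  -- The summand `s = 0` is the full even product; every other one is divisible by `x^{4n+2}`.
  have h0 : evenProd x n 0 * oddProd x 0 * x ^ (2 * 0 * (2 * n + 1)) =
      ∏ j ∈ Finset.range n, (1 - x ^ (4 * (j + 1))) := by
    simp [evenProd, oddProd]
  rw [h0, add_sub_cancel_right]
  refine Finset.dvd_sum fun s _ => Dvd.dvd.mul_left (pow_dvd_pow x ?_) _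
  nlinarith

end Gauss

/-! ### Counting the partitions in `𝔓_tdo` -/

/-- Twice the weight, a natural number. -/
def twoWeight (p : ℕ × Finset ℕ) : ℕ := p.1 * (p.1 + 1) + ∑ k ∈ p.2, (2 * k + 1)

theorem coeff_tdo {d N M : ℕ} (hN : d ≤ N) (hM : d < M) : PowerSeries.coeff d
    ((∏ j ∈ Finset.range N, (1 + PowerSeries.X ^ (2 * j + 1) : PowerSeries ℤ)) *
      ∑ m ∈ Finset.range M, (PowerSeries.X ^ (m * (m + 1)) : PowerSeries ℤ)) =
    (Nat.card {p : ℕ × Finset ℕ // twoWeight p = d} : ℕ) ∧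
    Finite {p : ℕ × Finset ℕ // twoWeight p = d} := by
  classical
  have key : {p : ℕ × Finset ℕ | twoWeight p = d} =
      ((Finset.range M ×ˢ (Finset.range N).powerset).filter fun p => twoWeight p = d : Finset _) := by
    ext ⟨m, S⟩
    simp only [Set.mem_ofPred_eq, Finset.coe_filter, Finset.mem_product, Finset.mem_range,
      Finset.mem_powerset]
    refine ⟨fun h => ⟨⟨?_, fun k hk => ?_⟩, h⟩, fun h => h.2⟩
    · have : m ≤ m * (m + 1) := Nat.le_mul_of_pos_right m (Nat.succ_pos m)
      simp only [twoWeight] at h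
      omega
    · have : 2 * k + 1 ≤ ∑ k ∈ S, (2 * k + 1) :=
        Finset.single_le_sum (f := fun k => 2 * k + 1) (fun _ _ => Nat.zero_le _) hk
      simp only [twoWeight] at h
      rw [Finset.mem_range]
      omega
  have hfin : Finite {p : ℕ × Finset ℕ // twoWeight p = d} := by
    change Finite ({p : ℕ × Finset ℕ | twoWeight p = d} : Set _)
    rw [key]
    exact Finset.finite_toSet _
  refine ⟨?_, hfin⟩
  have hcard : Nat.card {p : ℕ × Finset ℕ // twoWeight p = d} =
      ((Finset.range M ×ˢ (Finset.range N).powerset).filter fun p => twoWeight p = d).card := by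
    rw [← Set.ncard_coe_finset, ← key]
    rfl
  rw [hcard, Finset.prod_one_add, mul_comm, Finset.sum_mul_sum, ← Finset.sum_product', map_sum,
    Finset.card_filter]
  push_cast
  refine Finset.sum_congr rfl fun p _ => ?_
  rw [Finset.prod_pow_eq_pow_sum, ← pow_add, PowerSeries.coeff_X_pow]
  simp only [twoWeight, eq_comm]

/-- Both cardinalities are coefficients of `t^d`. Working modulo `t^{d+1}` replaces the infinite
products by finite ones. -/
theorem card_tdo_eq (d : ℕ) : Nat.card {p : ℕ × Finset ℕ // twoWeight p = d} =
    Nat.card {π : DistinctBipartition // π.twoW = d} := by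
  have h1 := (coeff_tdo (d := d) (N := d + 1) (M := 2 * (d + 1) + 1) (by omega) (by omega)).1
  have h2 := coeff_gradedDim_vacuumSpace (d := d) (N := d + 1) (by omega)
  rw [(card_bipartition d).2] at h2
  rw [← Nat.cast_inj (R := ℤ), ← h1, ← h2]
  have h3 : (PowerSeries.X : PowerSeries ℤ) ^ (d + 1) ∣
      (∏ j ∈ Finset.range (d + 1), (1 - PowerSeries.X ^ (2 * j + 1) : PowerSeries ℤ)) *
        gradedDim ⊤ - 1 := by
    rw [PowerSeries.X_pow_dvd_iff]
    intro e he
    rw [map_sub, coeff_gradedDim_top (by omega), PowerSeries.coeff_one, sub_self]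
  have h4 := (pow_dvd_pow (PowerSeries.X : PowerSeries ℤ) (show d + 1 ≤ 4 * (d + 1) + 2 by omega)).trans
    (gauss_dvd (PowerSeries.X : PowerSeries ℤ) (d + 1))
  have h5 : oddProd (PowerSeries.X : PowerSeries ℤ) (d + 1) =
      (∏ j ∈ Finset.range (d + 1), (1 - PowerSeries.X ^ (2 * j + 1) : PowerSeries ℤ)) *
      ∏ j ∈ Finset.range (d + 1), (1 + PowerSeries.X ^ (2 * j + 1) : PowerSeries ℤ) := by
    rw [oddProd, ← Finset.prod_mul_distrib]
    refine Finset.prod_congr rfl fun j _ => ?_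
    ring
  rw [h5] at h4
  generalize (∏ j ∈ Finset.range (d + 1), (1 - PowerSeries.X ^ (2 * j + 1) : PowerSeries ℤ)) = A
    at h3 h4
  generalize (∏ j ∈ Finset.range (d + 1), (1 + PowerSeries.X ^ (2 * j + 1) : PowerSeries ℤ)) = B
    at h4 ⊢
  generalize (∏ j ∈ Finset.range (d + 1), (1 - PowerSeries.X ^ (4 * (j + 1)) : PowerSeries ℤ)) = E
    at h4 ⊢
  generalize (∑ m ∈ Finset.range (2 * (d + 1) + 1),
    (PowerSeries.X ^ (m * (m + 1)) : PowerSeries ℤ)) = S at h4 ⊢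
  -- With `G` the graded dimension of Fock space, `E G - B S` combines Gauss' congruence `E ≡ A B S`
  -- with `A G ≡ 1`.
  have h6 := dvd_add (h4.mul_right (gradedDim ⊤)) (h3.mul_left (B * S))
  rw [show (E - A * B * S) * gradedDim ⊤ + B * S * (A * gradedDim ⊤ - 1) =
    E * gradedDim ⊤ - B * S by ring, PowerSeries.X_pow_dvd_iff] at h6
  have h7 := h6 d (Nat.lt_succ_self d)
  rw [map_sub, sub_eq_zero] at h7
  exact h7.symm

theorem two_mul_tri_injective {m m' : ℕ} (h : m * (m + 1) = m' * (m' + 1)) : m = m' := by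
  nlinarith [lt_trichotomy m m']

/-- The description of `𝔓_tdo` by natural numbers. -/
def tdoEquiv : ℕ × Finset ℕ ≃ TriDistinctHalf := by
  classical
  refine Equiv.ofBijective (fun p => ⟨p.1 * (p.1 + 1) / 2,
    ⟨p.1, Nat.mul_div_cancel' (Nat.even_mul_succ_self _).two_dvd⟩,
    p.2.image fun k : ℕ => (1 / 2 : ℚ) + k, ?_⟩) ⟨?_, ?_⟩
  · intro x hx
    obtain ⟨k, _, rfl⟩ := Finset.mem_image.1 hx
    exact ⟨k, rfl⟩
  · rintro ⟨m, S⟩ ⟨m', S'⟩ h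
    rw [TriDistinctHalf.mk.injEq] at h
    obtain ⟨h1, h2⟩ := h
    have h3 : m = m' := two_mul_tri_injective (by
      have e1 := Nat.mul_div_cancel' (Nat.even_mul_succ_self m).two_dvd
      have e2 := Nat.mul_div_cancel' (Nat.even_mul_succ_self m').two_dvd
      simp only at e1 e2 h1
      omega)
    have h4 : S = S' := Finset.image_injective (fun a b hab => by simpa using hab) h2
    rw [h3, h4]
  · rintro ⟨t, ⟨m, hm⟩, P, hP⟩
    choose! f hf using id hP
    refine ⟨(m, P.image f), ?_⟩
    rw [TriDistinctHalf.mk.injEq]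
    refine ⟨?_, ?_⟩
    · change m * (m + 1) / 2 = t
      omega
    · rw [Finset.image_image]
      ext x
      simp only [Finset.mem_image, Function.comp_apply]
      refine ⟨?_, fun hx => ⟨x, hx, (hf x hx).symm⟩⟩
      rintro ⟨y, hy, rfl⟩
      rwa [← hf y hy]

theorem weight_tdoEquiv (p : ℕ × Finset ℕ) : 2 * (tdoEquiv p).weight = twoWeight p := by
  classical
  change 2 * (((p.1 * (p.1 + 1) / 2 : ℕ) : ℚ) +
    ∑ x ∈ p.2.image fun k : ℕ => (1 / 2 : ℚ) + k, x) = _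
  have h := Nat.mul_div_cancel' (Nat.even_mul_succ_self p.1).two_dvd
  have h' : (2 : ℚ) * ((p.1 * (p.1 + 1) / 2 : ℕ) : ℚ) = ((p.1 * (p.1 + 1) : ℕ) : ℚ) := by
    exact_mod_cast h
  rw [Finset.sum_image (fun a _ b _ hab => by simpa using hab), mul_add, h', twoWeight,
    Finset.mul_sum]
  push_cast
  congr 1
  refine Finset.sum_congr rfl fun k _ => ?_
  ring

/-- A weight preserving bijection between `𝔓_tdo` and `𝔅𝔓_DI` with the weight `W`. -/
theorem exists_equiv_weight :
    ∃ e : TriDistinctHalf ≃ DistinctBipartition, ∀ p, p.weight = (e p).W := by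
  have h : ∀ d : ℕ, Nonempty ({p : ℕ × Finset ℕ // twoWeight p = d} ≃
      {π : DistinctBipartition // π.twoW.toNat = d}) := by
    intro d
    have := (coeff_tdo (d := d) (N := d) (M := d + 1) le_rfl (Nat.lt_succ_self d)).2
    have := (card_bipartition d).1
    exact (Finite.card_eq.1 (card_tdo_eq d)).map fun g =>
      g.trans (Equiv.subtypeEquivRight fun π => by
        have := twoW_nonneg π
        omega)
  let f := fun d => (h d).some
  -- Arbitrary bijections between fibres of equal finite cardinality are glued together.
  let e : ℕ × Finset ℕ ≃ DistinctBipartition := (Equiv.sigmaFiberEquiv twoWeight).symm.trans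
    ((Equiv.sigmaCongrRight f).trans (Equiv.sigmaFiberEquiv fun π : DistinctBipartition => π.twoW.toNat))
  have he : ∀ p, (e p).twoW = twoWeight p := by
    intro p
    have h1 : (e p).twoW.toNat = twoWeight p := (f (twoWeight p) ⟨p, rfl⟩).2
    have := twoW_nonneg (e p)
    omega
  refine ⟨tdoEquiv.symm.trans e, fun p => ?_⟩
  obtain ⟨p, rfl⟩ := tdoEquiv.surjective p
  rw [Equiv.trans_apply, Equiv.symm_apply_apply]
  have h1 := weight_tdoEquiv p
  have h2 := twoW_cast (e p)
  rw [he] at h2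
  push_cast at h2
  linarith

/-! ### The basis of the space of highest weight vectors -/

theorem exists_basis_vector : ∃ b : Module.Basis DistinctBipartition ℂ highestWeightSpace,
    ∀ π, (b π : Fock) = π.vector := by
  rw [highestWeightSpace_eq]
  exact ⟨Module.Basis.span linearIndependent_vector,
    fun π => Module.Basis.coe_span_apply linearIndependent_vector π⟩

theorem W_eq (π : DistinctBipartition) :
    3 * (π.fst.card : ℚ) / 2 + 2 * partSum π.fst - 2 * triangular π.fst.card
      + 2 * (π.fst.card : ℚ) * (π.snd.card : ℚ)
      + (π.snd.card : ℚ) / 2 + 2 * partSum π.snd - 2 * triangular π.snd.card = π.W := by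
  simp only [triangular, DistinctBipartition.W, DistinctBipartition.weight]
  ring

theorem W_of_snd_empty {π : DistinctBipartition} (h : π.snd = ∅) :
    3 * (π.fst.card : ℚ) / 2 + 2 * partSum π.fst - 2 * triangular π.fst.card = π.W := by
  rw [← W_eq, h]
  simp [triangular, partSum]

theorem W_of_fst_empty {π : DistinctBipartition} (h : π.fst = ∅) :
    (π.snd.card : ℚ) / 2 + 2 * partSum π.snd - 2 * triangular π.snd.card = π.W := by
  rw [← W_eq, h]
  simp [triangular, partSum]

theorem exists_W_eq_half (π : DistinctBipartition) : ∃ k : ℕ, π.W = (k : ℚ) / 2 := by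
  obtain ⟨k, hk⟩ := Int.eq_ofNat_of_zero_le (twoW_nonneg π)
  refine ⟨k, ?_⟩
  have := twoW_cast π
  rw [hk] at this
  push_cast at this
  linarith

theorem exists_weight_ne_W : ∃ π : DistinctBipartition, π.W ≠ π.weight := by
  -- For `(1 | ∅)` the weight is `1`, while `W = 3/2`.
  refine ⟨⟨{1}, ∅⟩, ?_⟩
  simp only [DistinctBipartition.W, DistinctBipartition.weight, partSum]
  norm_num

end

end CKP

theorem mainTheorem4 :
    ∃ (b : Module.Basis CKP.DistinctBipartition ℂ CKP.highestWeightSpace)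
      (e : CKP.TriDistinctHalf ≃ CKP.DistinctBipartition),
      (∀ π, (b π : CKP.Fock) = π.vector) ∧
      (∀ π, CKP.IsHighestWeight (b π : CKP.Fock)) ∧
      (∀ π, CKP.HasCharge (b π : CKP.Fock) (π.birank : ℂ)) ∧
      (∀ π : CKP.DistinctBipartition, π.snd = ∅ →
        CKP.HasDegree (b π : CKP.Fock)
            ((3 * (π.fst.card : ℚ) / 2 + 2 * CKP.partSum π.fst
              - 2 * CKP.triangular π.fst.card : ℚ) : ℂ) ∧
          3 * (π.fst.card : ℚ) / 2 + 2 * CKP.partSum π.fst - 2 * CKP.triangular π.fst.card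
            = 2 * CKP.partSum π.fst - (π.fst.card : ℚ) * (2 * (π.fst.card : ℚ) - 1) / 2) ∧
      (∀ π : CKP.DistinctBipartition, π.fst = ∅ →
        CKP.HasDegree (b π : CKP.Fock)
            (((π.snd.card : ℚ) / 2 + 2 * CKP.partSum π.snd
              - 2 * CKP.triangular π.snd.card : ℚ) : ℂ) ∧
          (π.snd.card : ℚ) / 2 + 2 * CKP.partSum π.snd - 2 * CKP.triangular π.snd.card
            = 2 * CKP.partSum π.snd - (π.snd.card : ℚ) * (2 * (π.snd.card : ℚ) + 1) / 2) ∧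
      (∀ π, CKP.HasDegree (b π : CKP.Fock) (π.W : ℂ)) ∧
      (∀ π : CKP.DistinctBipartition,
        3 * (π.fst.card : ℚ) / 2 + 2 * CKP.partSum π.fst - 2 * CKP.triangular π.fst.card
          + 2 * (π.fst.card : ℚ) * (π.snd.card : ℚ)
          + (π.snd.card : ℚ) / 2 + 2 * CKP.partSum π.snd - 2 * CKP.triangular π.snd.card = π.W) ∧
      (∀ π : CKP.DistinctBipartition, ∃ k : ℕ, π.W = (k : ℚ) / 2) ∧
      (∀ p, CKP.HasDegree (b (e p) : CKP.Fock) (p.weight : ℂ)) ∧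
      (∀ p, p.weight = (e p).W) ∧
      (∃ p, p.weight ≠ (e p).weight) := by
  obtain ⟨b, hb⟩ := CKP.exists_basis_vector
  obtain ⟨e, he⟩ := CKP.exists_equiv_weight
  refine ⟨b, e, hb, fun π => hb π ▸ CKP.isHighestWeight_vector π,
    fun π => hb π ▸ CKP.hasCharge_vector π, fun π h => ⟨?_, ?_⟩,
    fun π h => ⟨?_, ?_⟩, fun π => hb π ▸ CKP.hasDegree_vector π, CKP.W_eq,
    CKP.exists_W_eq_half, fun p => ?_, he, ?_⟩
  · rw [hb, CKP.W_of_snd_empty h]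
    exact CKP.hasDegree_vector π
  · simp only [CKP.triangular]
    ring
  · rw [hb, CKP.W_of_fst_empty h]
    exact CKP.hasDegree_vector π
  · simp only [CKP.triangular]
    ring
  · rw [hb, he]
    exact CKP.hasDegree_vector (e p)
  · obtain ⟨π, hπ⟩ := CKP.exists_weight_ne_W
    refine ⟨e.symm π, ?_⟩
    rw [he, e.apply_symm_apply]
    exact hπ
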